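/- **Theorem 8.3 (hyperrectangles:spectrum).** Let $d\ge 2$, $a_1,\dots,a_d>0$ and $Q=(-a_1,a_1)\times\dots\times(-a_d,a_d)\subset\mathbb R^d$. For $\alpha\in\mathbb C$ let $-\Delta_Q^\alpha$ be the Robin Laplacian, i.e. the operator in $L^2(Q)$ (complex-valued functions) associated with the form $$a_\alpha[u,v]=\int_Q\nabla u\cdot\overline{\nabla v}\,dx+\alpha\int_{\partial Q}u\,\overline v\,d\sigma,\qquad u,v\in H^1(Q)$$ (boundary values in the sense of traces): $u$ is in its domain, with $-\Delta_Q^\alpha u=h\in L^2(Q)$, if and only if $u\in H^1(Q)$ and $a_\alpha[u,v]=\int_Q h\,\overline v\,dx$ for all $v\in H^1(Q)$. Let $0<\varphi<\pi/2$ and let $T_\varphi^-=\{\alpha\in\mathbb C\setminus\{0\}:|\arg(-\alpha)|<\varphi\}$, where $\arg$ is the principal argument. An *eigencurve* is a function $\lambda$ such that, for all $\alpha\in T_\varphi^-$ with $|\alpha|$ large enough, $\lambda$ is analytic at $\alpha$ and $\lambda(\alpha)$ is an eigenvalue of $-\Delta_Q^\alpha$. All limits below are for $\alpha\to\infty$ in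 $T_\varphi^-$, $\lambda(\alpha)\sim c\,\alpha^2$ means $\lambda(\alpha)=c\,\alpha^2+o(\alpha^2)$ (for a constant $c\neq0$), and "eventually" means for all $\alpha\in T_\varphi^-$ with $|\alpha|$ large enough. 1. For each $j=1,\dots,d-1$ there are infinitely many divergent eigencurves with $\lambda(\alpha)\sim -j\alpha^2$: there are eigencurves $\lambda_0,\lambda_1,\lambda_2,\dots$ with $|\lambda_n(\alpha)|\to\infty$ and $\lambda_n(\alpha)\sim-j\alpha^2$ for every $n$, such that for all $m\ne n$ eventually $\lambda_m(\alpha)\neq\lambda_n(\alpha)$. 2. Counted with algebraic multiplicity there are exactly $2^d$ eigenvalues which behave like $-d\alpha^2$: there are eigencurves $\lambda_1,\dots,\lambda_{2^d}$ with $\lambda_i(\alpha)\sim-d\alpha^2$ for every $i$, such that eventually, for every $i$, the algebraic multiplicity of the eigenvalue $\lambda_i(\alpha)$ of $-\Delta_Q^\alpha$ equals the number of indices $k$ with $\lambda_k(\alpha)=\lambda_i(\alpha)$; and if $\mu(\alpha)$ is eventually an eigenvalue of $-\Delta_Q^\alpha$ (not necessarily depending analytically on $\alpha$) with $\mu(\alpha)\sim-d\alpha^2$,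 then eventually $\mu(\alpha)\in\{\lambda_1(\alpha),\dots,\lambda_{2^d}(\alpha)\}$. -/

import Mathlib

open MeasureTheory Filter Topology Asymptotics Bornology
open scoped ContDiff

noncomputable section

namespace RobinBox

/-- The open hyperrectangle `(-a 0, a 0) × ⋯ × (-a (d-1), a (d-1))` in `ℝ^d`. Only coordinates,
Lebesgue measure and smoothness on `ℝ^d` are used below, so `ℝ^d` is `Fin d → ℝ`. -/
def box {d : ℕ} (a : Fin d → ℝ) : Set (Fin d → ℝ) :=
  Set.univ.pi fun i => Set.Ioo (-a i) (a i)

/-- Lebesgue measure on the hyperrectangle. -/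
def boxMeasure {d : ℕ} (a : Fin d → ℝ) : Measure (Fin d → ℝ) :=
  volume.restrict (box a)

/-- The `(d-1)`-dimensional Lebesgue measure on the face `{x | x j = c, |x i| < a i for i ≠ j}`:
the product of a Dirac mass in the coordinate `j` and of Lebesgue measures in the others. -/
def faceMeasure {d : ℕ} (a : Fin d → ℝ) (j : Fin d) (c : ℝ) : Measure (Fin d → ℝ) :=
  Measure.pi (Function.update
    (fun i => (volume : Measure ℝ).restrict (Set.Ioo (-a i) (a i))) j (Measure.dirac c))

/-- Surface measure on the boundary of the hyperrectangle: the sum over its `2 d` faces. -/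
def surfaceMeasure {d : ℕ} (a : Fin d → ℝ) : Measure (Fin d → ℝ) :=
  ∑ j, (faceMeasure a j (-a j) + faceMeasure a j (a j))

/-- Complex `L²` of the hyperrectangle. -/
abbrev L2Box {d : ℕ} (a : Fin d → ℝ) := Lp ℂ 2 (boxMeasure a)

/-- Complex `L²` of the boundary of the hyperrectangle. -/
abbrev L2Bdry {d : ℕ} (a : Fin d → ℝ) := Lp ℂ 2 (surfaceMeasure a)

/-- The `i`-th classical partial derivative. -/
def partialDeriv {d : ℕ} (i : Fin d) (f : (Fin d → ℝ) → ℂ) (x : Fin d → ℝ) : ℂ :=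
  fderiv ℝ f x (Pi.single i 1)

/-- `G` is the weak gradient of `u` on the hyperrectangle. Thus `u ∈ H¹` if and only if there is
`G` (with components in `L²`) such that `HasWeakGradient a u G`. -/
def HasWeakGradient {d : ℕ} (a : Fin d → ℝ) (u : L2Box a) (G : Fin d → L2Box a) : Prop :=
  ∀ f : (Fin d → ℝ) → ℂ, ContDiff ℝ ∞ f → HasCompactSupport f → tsupport f ⊆ box a →
    ∀ i, ∫ x, u x * partialDeriv i f x ∂(boxMeasure a) = -∫ x, G i x * f x ∂(boxMeasure a)

lemma contDiff_partialDeriv {d : ℕ} (i : Fin d) {f : (Fin d → ℝ) → ℂ} (hf : ContDiff ℝ ∞ f) :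
    ContDiff ℝ ∞ (partialDeriv i f) := by
  unfold partialDeriv
  exact (hf.fderiv_right (m := ∞) (by simp)).clm_apply contDiff_const

lemma box_subset {d : ℕ} (a : Fin d → ℝ) : box a ⊆ Set.Icc (-a) a := by
  intro x hx
  exact ⟨fun i => (hx i trivial).1.le, fun i => (hx i trivial).2.le⟩

instance isFiniteMeasure_boxMeasure {d : ℕ} (a : Fin d → ℝ) : IsFiniteMeasure (boxMeasure a) :=
  ⟨by
    rw [boxMeasure, Measure.restrict_apply_univ]
    exact (measure_mono (box_subset a)).trans_lt isCompact_Icc.measure_lt_top⟩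

lemma integrable_mul_continuous {d : ℕ} (a : Fin d → ℝ) (u : L2Box a)
    {f : (Fin d → ℝ) → ℂ} (hf : Continuous f) :
    Integrable (fun x => u x * f x) (boxMeasure a) := by
  have hu : Integrable (fun x => u x) (boxMeasure a) := (Lp.memLp u).integrable (by norm_num)
  obtain ⟨C, hC⟩ := (isCompact_Icc (a := -a) (b := a)).exists_bound_of_continuousOn hf.continuousOn
  refine hu.mul_bdd (c := C) hf.aestronglyMeasurable ?_
  have hm : MeasurableSet (box a) := MeasurableSet.univ_pi fun i => measurableSet_Ioo
  exact (ae_restrict_iff' hm).2 (Eventually.of_forall fun x hx => hC x (box_subset a hx))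

lemma HasWeakGradient.zero {d : ℕ} (a : Fin d → ℝ) : HasWeakGradient a 0 0 := by
  intro f _ _ _ i
  have h : ∀ᵐ x ∂(boxMeasure a), (0 : L2Box a) x = 0 := Lp.coeFn_zero _ _ _
  rw [integral_eq_zero_of_ae, integral_eq_zero_of_ae, neg_zero]
  · filter_upwards [h] with x hx
    change (0 : L2Box a) x * _ = 0
    rw [hx, zero_mul]
  · filter_upwards [h] with x hx
    change (0 : L2Box a) x * _ = 0
    rw [hx, zero_mul]

lemma HasWeakGradient.add {d : ℕ} {a : Fin d → ℝ} {u v : L2Box a} {G H : Fin d → L2Box a}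
    (hu : HasWeakGradient a u G) (hv : HasWeakGradient a v H) :
    HasWeakGradient a (u + v) (G + H) := by
  intro f hf hc hs i
  have key : ∀ (p q : L2Box a) (g : (Fin d → ℝ) → ℂ), Continuous g →
      ∫ x, (p + q) x * g x ∂(boxMeasure a) =
        ∫ x, p x * g x ∂(boxMeasure a) + ∫ x, q x * g x ∂(boxMeasure a) := by
    intro p q g hg
    rw [← integral_add (integrable_mul_continuous a p hg) (integrable_mul_continuous a q hg)]
    refine integral_congr_ae ?_
    filter_upwards [Lp.coeFn_add p q] with x hx
    rw [hx, Pi.add_apply, add_mul]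
  rw [key _ _ _ (contDiff_partialDeriv i hf).continuous, Pi.add_apply, key _ _ _ hf.continuous,
    hu f hf hc hs i, hv f hf hc hs i]
  ring

lemma HasWeakGradient.smul {d : ℕ} {a : Fin d → ℝ} {u : L2Box a} {G : Fin d → L2Box a}
    (c : ℂ) (hu : HasWeakGradient a u G) : HasWeakGradient a (c • u) (c • G) := by
  intro f hf hc hs i
  have key : ∀ (p : L2Box a) (g : (Fin d → ℝ) → ℂ),
      ∫ x, (c • p) x * g x ∂(boxMeasure a) = c * ∫ x, p x * g x ∂(boxMeasure a) := by
    intro p g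
    rw [← integral_const_mul]
    refine integral_congr_ae ?_
    filter_upwards [Lp.coeFn_smul c p] with x hx
    rw [hx, Pi.smul_apply, smul_eq_mul, mul_assoc]
  rw [key, Pi.smul_apply, key, hu f hf hc hs i]
  ring

/-- The triples `(f, ∇f, f|_{boundary})` for `f` smooth on `ℝ^d`. -/
def smoothTriples {d : ℕ} (a : Fin d → ℝ) :
    Submodule ℂ (L2Box a × (Fin d → L2Box a) × L2Bdry a) where
  carrier := {p | ∃ f : (Fin d → ℝ) → ℂ, ContDiff ℝ ∞ f ∧ p.1 =ᵐ[boxMeasure a] f ∧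
    (∀ i, p.2.1 i =ᵐ[boxMeasure a] partialDeriv i f) ∧ p.2.2 =ᵐ[surfaceMeasure a] f}
  zero_mem' := by
    refine ⟨0, contDiff_const, Lp.coeFn_zero _ _ _, fun i => ?_, Lp.coeFn_zero _ _ _⟩
    filter_upwards [Lp.coeFn_zero ℂ 2 (boxMeasure a)] with x hx
    change (0 : L2Box a) x = _
    rw [hx]
    have h0 : (0 : (Fin d → ℝ) → ℂ) = fun _ => 0 := rfl
    simp [partialDeriv, h0]
  add_mem' := by
    rintro p q ⟨f, hf, hf1, hf2, hf3⟩ ⟨g, hg, hg1, hg2, hg3⟩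
    refine ⟨f + g, hf.add hg, ?_, fun i => ?_, ?_⟩
    · exact (Lp.coeFn_add p.1 q.1).trans (hf1.add hg1)
    · refine (Lp.coeFn_add (p.2.1 i) (q.2.1 i)).trans (((hf2 i).add (hg2 i)).trans ?_)
      refine Eventually.of_forall fun x => ?_
      have h1 := (hf.differentiable (by simp)).differentiableAt (x := x)
      have h2 := (hg.differentiable (by simp)).differentiableAt (x := x)
      simp [partialDeriv, fderiv_add h1 h2]
    · exact (Lp.coeFn_add p.2.2 q.2.2).trans (hf3.add hg3)
  smul_mem' := by
    rintro c p ⟨f, hf, hf1, hf2, hf3⟩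
    refine ⟨c • f, contDiff_const.smul hf, ?_, fun i => ?_, ?_⟩
    · exact (Lp.coeFn_smul c p.1).trans (hf1.const_smul c)
    · refine (Lp.coeFn_smul c (p.2.1 i)).trans (((hf2 i).const_smul c).trans ?_)
      refine Eventually.of_forall fun x => ?_
      have h1 := (hf.differentiable (by simp)).differentiableAt (x := x)
      simp [partialDeriv, fderiv_const_smul h1]
    · exact (Lp.coeFn_smul c p.2.2).trans (hf3.const_smul c)

/-- `u ∈ H¹` of the hyperrectangle, with weak gradient `G` and boundary trace `g`. The trace operator
`H¹ → L²(boundary)` is the continuous extension of the restriction of functions that are smooth up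
to the boundary: there are smooth `f n` with `f n → u` and `∇ (f n) → G` in `L²` and with
`f n → g` in `L²` of the boundary. Every `u ∈ H¹` has exactly one such `G` and `g`. -/
def HasGradientAndTrace {d : ℕ} (a : Fin d → ℝ) (u : L2Box a) (G : Fin d → L2Box a)
    (g : L2Bdry a) : Prop :=
  HasWeakGradient a u G ∧ (u, G, g) ∈ (smoothTriples a).topologicalClosure

/-- The graph of the Robin Laplacian with parameter `α`, i.e. of the operator in `L²` that is
associated with the form `a_α[u, v] = ∫ ∇u · conj ∇v dx + α ∫ u conj v dσ` on `H¹`: the pairs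
`(u, h)` with `u ∈ H¹`, `h ∈ L²` and `a_α[u, v] = ∫ h conj v dx` for all `v ∈ H¹`. -/
def robinLaplacian {d : ℕ} (a : Fin d → ℝ) (α : ℂ) : Submodule ℂ (L2Box a × L2Box a) where
  carrier := {p | ∃ G g, HasGradientAndTrace a p.1 G g ∧
    ∀ v H k, HasGradientAndTrace a v H k →
      ∑ i, inner ℂ (H i) (G i) + α * inner ℂ k g = inner ℂ v p.2}
  zero_mem' := by
    refine ⟨0, 0, ⟨HasWeakGradient.zero a, Submodule.zero_mem _⟩, fun v H k _ => ?_⟩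
    simp
  add_mem' := by
    rintro p q ⟨G, g, hG, h⟩ ⟨G', g', hG', h'⟩
    refine ⟨G + G', g + g', ⟨hG.1.add hG'.1, Submodule.add_mem _ hG.2 hG'.2⟩, fun v H k hv => ?_⟩
    simp only [Pi.add_apply, inner_add_right, Finset.sum_add_distrib, Prod.snd_add,
      ← h v H k hv, ← h' v H k hv]
    ring
  smul_mem' := by
    rintro c p ⟨G, g, hG, h⟩
    refine ⟨c • G, c • g, ⟨hG.1.smul c, Submodule.smul_mem _ c hG.2⟩, fun v H k hv => ?_⟩
    simp only [Pi.smul_apply, inner_smul_right, Prod.smul_snd, ← h v H k hv, ← Finset.mul_sum]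
    ring

/-- `μ` is an eigenvalue of the Robin Laplacian with parameter `α`. -/
def IsRobinEigenvalue {d : ℕ} (a : Fin d → ℝ) (α μ : ℂ) : Prop :=
  ∃ u : L2Box a, u ≠ 0 ∧ (u, μ • u) ∈ robinLaplacian a α

/-- The kernel of the `n`-th power of `A - μ`, where `A` is the Robin Laplacian: `u` is in the
kernel of the power `n + 1` if `u` is in the domain of `A` and `A u - μ u` is in the kernel of the
power `n`. -/
def kerPow {d : ℕ} (a : Fin d → ℝ) (α μ : ℂ) : ℕ → Submodule ℂ (L2Box a)
  | 0 => ⊥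
  | n + 1 => Submodule.map (LinearMap.fst ℂ (L2Box a) (L2Box a))
      (robinLaplacian a α ⊓ Submodule.comap
        (LinearMap.snd ℂ (L2Box a) (L2Box a) - μ • LinearMap.fst ℂ (L2Box a) (L2Box a))
        (kerPow a α μ n))

/-- The algebraic multiplicity of `μ` as an eigenvalue of the Robin Laplacian: the dimension of the
space of all generalised eigenfunctions. -/
def algMultiplicity {d : ℕ} (a : Fin d → ℝ) (α μ : ℂ) : ℕ :=
  Module.finrank ℂ (⨆ n, kerPow a α μ n : Submodule ℂ (L2Box a))

/-- The open sector around the positive real axis with half-angle `φ`. -/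
def sectorPos (φ : ℝ) : Set ℂ := {z | z ≠ 0 ∧ |z.arg| < φ}

/-- The open sector around the negative real axis with half-angle `φ`. -/
def sectorNeg (φ : ℝ) : Set ℂ := {z | -z ∈ sectorPos φ}

/-- The filter of the limit `α → ∞` inside the sector around the negative real axis. -/
def sectorAtInfty (φ : ℝ) : Filter ℂ := cobounded ℂ ⊓ 𝓟 (sectorNeg φ)

/-- `lam` is an analytic curve of eigenvalues `lam α` of the Robin Laplacian with parameter `α`, for
all `α` in the sector around the negative real axis with `|α|` large enough. -/
def IsEigencurve {d : ℕ} (a : Fin d → ℝ) (φ : ℝ) (lam : ℂ → ℂ) : Prop :=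
  ∀ᶠ α in sectorAtInfty φ, IsRobinEigenvalue a α (lam α) ∧ AnalyticAt ℂ lam α

end RobinBox

end

/-!
Separation of variables gives the modes `∏ i, cos (κ i * x i - phase (b i))`, where `κ i * a i` is a
root of a transcendental characteristic function that depends on the parity `b i`; the mode has
eigenvalue `∑ i, κ i ^ 2`. The operator is not self-adjoint, so completeness of the modes needs an
argument: if `u` is orthogonal to all conjugate modes, then in each coordinate its cosine transform
vanishes at the zeros of the characteristic function, which are simple, and the quotient of the two
is entire and tends to zero on large squares, hence vanishes. Fourier uniqueness gives `u = 0`.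
Therefore every eigenvalue is `∑ i, κ i ^ 2` for some mode, and a generalised eigenfunction is
determined by its products with the modes of the same eigenvalue.

In the sector the contraction principle shows that each coordinate has, up to sign, exactly one root
of each parity with frequency close to `-I * α`; all other frequencies have imaginary parts that are
small compared with `‖α‖`. So eigenvalues close to `-d * α ^ 2` only come from large frequencies in
all coordinates, one for each of the `2 ^ d` choices of parities. Large frequencies in `j`
coordinates combined with bounded ones in the others, which converge to zeros of the cosine, give
infinitely many curves close to `-j * α ^ 2`.
-/

noncomputable section

namespace RobinBox

open Complex ComplexConjugate
open scoped Real

/-! ### Calculus on the box -/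

section Box

variable {d : ℕ} (a : Fin d → ℝ)

lemma memLp_of_ae_mem_isCompact {X : Type*} [TopologicalSpace X] [SecondCountableTopology X]
    [MeasurableSpace X] [OpensMeasurableSpace X] {μ : Measure X} [IsFiniteMeasure μ] {K : Set X}
    (hK : IsCompact K) (hμ : ∀ᵐ x ∂μ, x ∈ K) {f : X → ℂ} (hf : Continuous f) (p : ENNReal) :
    MemLp f p μ := by
  obtain ⟨C, hC⟩ := hK.exists_bound_of_continuousOn hf.continuousOn
  exact .of_bound hf.aestronglyMeasurable C (hμ.mono hC)

instance isFiniteMeasure_update (j : Fin d) (c : ℝ) (i : Fin d) :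
    IsFiniteMeasure (Function.update
      (fun i => (volume : Measure ℝ).restrict (Set.Ioo (-a i) (a i))) j (Measure.dirac c) i) := by
  rcases eq_or_ne i j with rfl | hij
  · rw [Function.update_self]; infer_instance
  · rw [Function.update_of_ne hij]; infer_instance

instance isFiniteMeasure_faceMeasure (j : Fin d) (c : ℝ) : IsFiniteMeasure (faceMeasure a j c) := by
  unfold faceMeasure
  infer_instance

instance isFiniteMeasure_surfaceMeasure : IsFiniteMeasure (surfaceMeasure a) := by
  unfold surfaceMeasure
  infer_instance

lemma ae_boxMeasure_mem_Icc : ∀ᵐ x ∂(boxMeasure a), x ∈ Set.Icc (-a) a :=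
  (ae_restrict_mem (MeasurableSet.univ_pi fun _ => measurableSet_Ioo)).mono
    fun _ hx => box_subset a hx

variable {a}

lemma ae_faceMeasure_mem_Icc {j : Fin d} {c : ℝ} (hc : |c| ≤ |a j|) :
    ∀ᵐ x ∂(faceMeasure a j c), x ∈ Set.Icc (-|a|) |a| := by
  have h (i : Fin d) : ∀ᵐ x ∂(faceMeasure a j c), |x i| ≤ |a i| := by
    refine Measure.tendsto_eval_ae_ae.eventually (p := fun t => |t| ≤ |a i|) ?_
    rcases eq_or_ne i j with rfl | hij
    · rw [Function.update_self]
      exact (ae_dirac_iff (measurableSet_le (by fun_prop) (by fun_prop))).2 hc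
    · rw [Function.update_of_ne hij]
      filter_upwards [ae_restrict_mem measurableSet_Ioo] with t ht
      exact (abs_lt.2 ht).le.trans (le_abs_self _)
  filter_upwards [ae_all_iff.2 h] with x hx
  exact ⟨fun i => (abs_le.1 (hx i)).1, fun i => (abs_le.1 (hx i)).2⟩

variable (a) in
lemma ae_surfaceMeasure_mem_Icc : ∀ᵐ x ∂(surfaceMeasure a), x ∈ Set.Icc (-|a|) |a| := by
  rw [surfaceMeasure, ← Measure.sum_fintype, Measure.ae_sum_iff]
  intro j
  rw [ae_add_measure_iff]
  exact ⟨ae_faceMeasure_mem_Icc (abs_neg _).le, ae_faceMeasure_mem_Icc le_rfl⟩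

lemma integrable_boxMeasure {f : (Fin d → ℝ) → ℂ} (hf : Continuous f) :
    Integrable f (boxMeasure a) :=
  (memLp_of_ae_mem_isCompact isCompact_Icc (ae_boxMeasure_mem_Icc a) hf 1).integrable le_rfl

lemma integral_surfaceMeasure {f : (Fin d → ℝ) → ℂ} (hf : Continuous f) :
    ∫ x, f x ∂(surfaceMeasure a) =
      ∑ j, (∫ x, f x ∂(faceMeasure a j (-a j)) + ∫ x, f x ∂(faceMeasure a j (a j))) := by
  have hint {j : Fin d} {c : ℝ} (hc : |c| ≤ |a j|) : Integrable f (faceMeasure a j c) :=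
    (memLp_of_ae_mem_isCompact isCompact_Icc (ae_faceMeasure_mem_Icc hc) hf 1).integrable le_rfl
  have hneg (j : Fin d) := hint (abs_neg (a j)).le
  have hpos (j : Fin d) := hint (le_refl |a j|)
  rw [surfaceMeasure, integral_finsetSum_measure fun j _ => (hneg j).add_measure (hpos j)]
  exact Finset.sum_congr rfl fun j _ => integral_add_measure (hneg j) (hpos j)

lemma integral_boxMeasure (f : (Fin d → ℝ) → ℂ) :
    ∫ x, f x ∂(boxMeasure a) = ∫ x in Set.Icc (-a) a, f x :=
  setIntegral_congr_set Measure.univ_pi_Ioo_ae_eq_Icc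

lemma integral_faceMeasure {n : ℕ} (a : Fin (n + 1) → ℝ) (j : Fin (n + 1)) (c : ℝ)
    {f : (Fin (n + 1) → ℝ) → ℂ} (hf : Continuous f) :
    ∫ x, f x ∂(faceMeasure a j c) =
      ∫ y in Set.Icc (-a ∘ j.succAbove) (a ∘ j.succAbove), f (j.insertNth c y) := by
  set ν : Measure (Fin n → ℝ) :=
    Measure.pi fun i => volume.restrict (Set.Ioo (-a (j.succAbove i)) (a (j.succAbove i)))
  have hν : ν = volume.restrict (box (a ∘ j.succAbove)) := by
    rw [box, volume_pi, Measure.restrict_pi_pi]; rfl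
  have hface : MeasurePreserving (MeasurableEquiv.piFinSuccAbove (fun _ => ℝ) j).symm
      ((Measure.dirac c).prod ν) (faceMeasure a j c) := by
    simpa only [Function.update_self, Function.update_of_ne (Fin.succAbove_ne j _),
      faceMeasure] using
      (measurePreserving_piFinSuccAbove (Function.update
        (fun i => (volume : Measure ℝ).restrict (Set.Ioo (-a i) (a i))) j (Measure.dirac c)) j).symm
  rw [← hface.integral_comp', Measure.dirac_prod, integral_map measurable_prodMk_left.aemeasurable]
  · rw [hν]
    exact integral_boxMeasure _
  · exact (hf.measurable.comp (MeasurableEquiv.measurable _)).aestronglyMeasurable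

lemma continuous_partialDeriv (i : Fin d) {f : (Fin d → ℝ) → ℂ} (hf : ContDiff ℝ 1 f) :
    Continuous (partialDeriv i f) :=
  (hf.continuous_fderiv one_ne_zero).clm_apply continuous_const

lemma integral_divergence_boxMeasure (ha : 0 ≤ a) {F : Fin d → (Fin d → ℝ) → ℂ}
    (hF : ∀ j, ContDiff ℝ 1 (F j)) :
    ∫ x, ∑ j, partialDeriv j (F j) x ∂(boxMeasure a) =
      ∑ j, (∫ x, F j x ∂(faceMeasure a j (a j)) - ∫ x, F j x ∂(faceMeasure a j (-a j))) := by
  obtain _ | n := d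
  · simp
  have hdiv : Continuous fun x => ∑ j, partialDeriv j (F j) x :=
    continuous_finsetSum _ fun j _ => continuous_partialDeriv j (hF j)
  rw [integral_boxMeasure]
  refine (integral_divergence_of_hasFDerivAt_off_countable' (-a) a (neg_le_self ha) F
    (fun j => fderiv ℝ (F j)) ∅ Set.countable_empty (fun j => (hF j).continuous.continuousOn)
    (fun x _ j => ((hF j).differentiable one_ne_zero x).hasFDerivAt)
    (hdiv.continuousOn.integrableOn_compact isCompact_Icc)).trans ?_
  simp only [integral_faceMeasure a _ _ (hF _).continuous]
  rfl

lemma hasWeakGradient_of_contDiff {f : (Fin d → ℝ) → ℂ} (hf : ContDiff ℝ 1 f) {u : L2Box a}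
    {G : Fin d → L2Box a} (hu : u =ᵐ[boxMeasure a] f)
    (hG : ∀ i, G i =ᵐ[boxMeasure a] partialDeriv i f) : HasWeakGradient a u G := by
  intro g hg hgc hgs i
  have extend {v : L2Box a} {p q : (Fin d → ℝ) → ℂ} (hv : v =ᵐ[boxMeasure a] p)
      (hq : ∀ x ∉ tsupport g, q x = 0) :
      ∫ x, v x * q x ∂(boxMeasure a) = ∫ x, p x * q x := by
    rw [integral_congr_ae (g := fun x => p x * q x) (hv.mono fun x hx => congrArg (· * q x) hx)]
    exact setIntegral_eq_integral_of_forall_compl_eq_zero fun x hx => by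
      rw [hq x fun h => hx (hgs h), mul_zero]
  have hdg : ∀ x ∉ tsupport g, partialDeriv i g x = 0 := fun x hx => by
    rw [partialDeriv, image_eq_zero_of_notMem_tsupport fun h => hx (tsupport_fderiv_subset ℝ h)]
    rfl
  rw [extend hu hdg, extend (hG i) fun x => image_eq_zero_of_notMem_tsupport]
  have hdgc : HasCompactSupport (partialDeriv i g) := hgc.fderiv_apply ℝ (Pi.single i (1 : ℝ))
  refine integral_mul_fderiv_eq_neg_fderiv_mul_of_integrable ?_ ?_ ?_
    (fun x _ => hf.differentiable one_ne_zero x) (fun x _ => hg.differentiable (by simp) x)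
  · exact ((continuous_partialDeriv i hf).mul hg.continuous).integrable_of_hasCompactSupport
      hgc.mul_left
  · exact (hf.continuous.mul (contDiff_partialDeriv i hg).continuous)
      |>.integrable_of_hasCompactSupport hdgc.mul_left
  · exact (hf.continuous.mul hg.continuous).integrable_of_hasCompactSupport hgc.mul_left

lemma inner_eq_integral {X : Type*} [MeasurableSpace X] {μ : Measure X} {u v : Lp ℂ 2 μ}
    {f g : X → ℂ} (hu : u =ᵐ[μ] f) (hv : v =ᵐ[μ] g) :
    inner ℂ u v = ∫ x, conj (f x) * g x ∂μ := by
  rw [L2.inner_def]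
  refine integral_congr_ae ?_
  filter_upwards [hu, hv] with x hux hvx
  rw [hux, hvx, RCLike.inner_apply, mul_comm]

end Box

/-! ### Separated modes -/

/-- The shift in `cos (k x - phase b)`, which is the even mode `cos (k x)` for `b = false` and the
odd mode `sin (k x)` for `b = true`. -/
def phase (b : Bool) : ℝ := if b then π / 2 else 0

/-- The sign by which the mode of parity `b` changes under reflection. -/
def paritySign (b : Bool) : ℂ := if b then -1 else 1

/-- The characteristic function of the one-dimensional Robin problem on `(-l, l)`: the mode
`cos (k x - phase b)` satisfies the Robin condition with parameter `α` at both end points if and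
only if `charFn b (α * l) (k * l) = 0`. -/
def charFn (b : Bool) (A z : ℂ) : ℂ := z * sin (z - phase b) - A * cos (z - phase b)

lemma norm_paritySign (b : Bool) : ‖paritySign b‖ = 1 := by cases b <;> simp [paritySign]

lemma cos_neg_sub_phase (b : Bool) (z : ℂ) :
    cos (-z - phase b) = paritySign b * cos (z - phase b) := by
  cases b <;> simp [phase, paritySign, cos_sub_pi_div_two]

lemma sin_neg_sub_phase (b : Bool) (z : ℂ) :
    sin (-z - phase b) = -(paritySign b * sin (z - phase b)) := by
  cases b <;> simp [phase, paritySign, sin_sub_pi_div_two]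

lemma charFn_neg (b : Bool) (A z : ℂ) : charFn b A (-z) = paritySign b * charFn b A z := by
  rw [charFn, charFn, cos_neg_sub_phase, sin_neg_sub_phase]
  ring

lemma conj_charFn (b : Bool) (A z : ℂ) : conj (charFn b A z) = charFn b (conj A) (conj z) := by
  simp [charFn, ← cos_conj, ← sin_conj]

section Calculus

variable {d : ℕ} {g : Fin d → ℝ → ℂ}

lemma partialDeriv_prod (hg : ∀ i, Differentiable ℝ (g i)) (j : Fin d) (x : Fin d → ℝ) :
    partialDeriv j (fun x => ∏ i, g i (x i)) x =
      deriv (g j) (x j) * ∏ i ∈ Finset.univ.erase j, g i (x i) := by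
  have hderiv := HasFDerivAt.finsetProd (u := Finset.univ) fun i _ =>
    (hg i (x i)).hasFDerivAt.comp x
      (ContinuousLinearMap.proj (R := ℝ) (φ := fun _ => ℝ) i).hasFDerivAt
  have happly : partialDeriv j (fun x => ∏ i, g i (x i)) x = _ :=
    congrArg (· (Pi.single j 1)) hderiv.fderiv
  rw [happly, sum_apply, Finset.sum_eq_single j]
  · simp [mul_comm]
  · intro i _ hij
    simp [Pi.single_eq_of_ne hij]
  · simp

lemma partialDeriv_partialDeriv_prod (hg : ∀ i, Differentiable ℝ (g i)) {j : Fin d}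
    (hj : Differentiable ℝ (deriv (g j))) (x : Fin d → ℝ) :
    partialDeriv j (partialDeriv j fun x => ∏ i, g i (x i)) x =
      deriv (deriv (g j)) (x j) * ∏ i ∈ Finset.univ.erase j, g i (x i) := by
  have hupd (h : ℝ → ℂ) (y : Fin d → ℝ) :
      ∏ i ∈ Finset.univ.erase j, Function.update g j h i (y i) =
        ∏ i ∈ Finset.univ.erase j, g i (y i) :=
    Finset.prod_congr rfl fun i hi => by rw [Function.update_of_ne (Finset.ne_of_mem_erase hi)]
  have hfirst : partialDeriv j (fun x => ∏ i, g i (x i)) =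
      fun y => ∏ i, Function.update g j (deriv (g j)) i (y i) := by
    funext y
    rw [partialDeriv_prod hg, ← Finset.mul_prod_erase _ _ (Finset.mem_univ j), hupd,
      Function.update_self]
  rw [hfirst, partialDeriv_prod, Function.update_self, hupd]
  intro i
  rcases eq_or_ne i j with rfl | hij
  · rwa [Function.update_self]
  · rw [Function.update_of_ne hij]; exact hg i

lemma hasDerivAt_cos_mul_sub (k p : ℂ) (t : ℝ) :
    HasDerivAt (fun s : ℝ => cos (k * s - p)) (-(k * sin (k * t - p))) t := by
  convert ((((hasDerivAt_id' (t : ℂ)).const_mul k).sub_const p).ccos).comp_ofReal using 1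
  ring

lemma hasDerivAt_neg_mul_sin_mul_sub (k p : ℂ) (t : ℝ) :
    HasDerivAt (fun s : ℝ => -(k * sin (k * s - p))) (-k ^ 2 * cos (k * t - p)) t := by
  convert ((((hasDerivAt_id' (t : ℂ)).const_mul k).sub_const p).csin.const_mul (-k)).comp_ofReal
    using 1
  · funext s
    ring
  · ring

end Calculus

section Modes

variable {d : ℕ} {a : Fin d → ℝ} {α : ℂ} {κ : Fin d → ℂ} {b : Fin d → Bool}

/-- The mode `∏ i, cos (κ i * x i - phase (b i))` with frequencies `κ` and parities `b`. -/
def mode (κ : Fin d → ℂ) (b : Fin d → Bool) (x : Fin d → ℝ) : ℂ :=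
  ∏ i, cos (κ i * x i - phase (b i))

/-- The frequencies `κ` solve the characteristic equations of all coordinates, so that the mode
`mode κ b` satisfies the Robin condition on the boundary of the box. -/
def IsRoot (a : Fin d → ℝ) (α : ℂ) (κ : Fin d → ℂ) (b : Fin d → Bool) : Prop :=
  ∀ i, charFn (b i) (α * a i) (κ i * a i) = 0

lemma IsRoot.conj (h : IsRoot a α κ b) : IsRoot a (conj α) (star κ) b := by
  intro i
  simpa [conj_charFn] using congrArg (starRingEnd ℂ) (h i)

variable (κ b)

lemma contDiff_mode : ContDiff ℝ ∞ (mode κ b) := by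
  refine contDiff_prod fun i _ => (contDiff_cos.restrict_scalars ℝ).comp ?_
  exact (contDiff_const.mul (ofRealCLM.contDiff.comp (contDiff_apply ℝ ℝ i))).sub contDiff_const

lemma partialDeriv_mode (j : Fin d) (x : Fin d → ℝ) :
    partialDeriv j (mode κ b) x = -(κ j * sin (κ j * x j - phase (b j))) *
      ∏ i ∈ Finset.univ.erase j, cos (κ i * x i - phase (b i)) := by
  rw [← (hasDerivAt_cos_mul_sub (κ j) (phase (b j)) (x j)).deriv]
  exact partialDeriv_prod (fun i t => (hasDerivAt_cos_mul_sub _ _ t).differentiableAt) j x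

lemma partialDeriv_partialDeriv_mode (j : Fin d) (x : Fin d → ℝ) :
    partialDeriv j (partialDeriv j (mode κ b)) x = -κ j ^ 2 * mode κ b x := by
  have hderiv : deriv (fun t : ℝ => cos (κ j * t - phase (b j))) =
      fun t : ℝ => -(κ j * sin (κ j * t - phase (b j))) :=
    funext fun t => (hasDerivAt_cos_mul_sub _ _ t).deriv
  have h := partialDeriv_partialDeriv_prod (j := j)
    (g := fun i t => cos (κ i * t - phase (b i)))
    (fun i t => (hasDerivAt_cos_mul_sub _ _ t).differentiableAt)
    (hderiv ▸ fun t => (hasDerivAt_neg_mul_sin_mul_sub _ _ t).differentiableAt) x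
  rw [hderiv, (hasDerivAt_neg_mul_sin_mul_sub _ _ _).deriv, mul_assoc,
    Finset.mul_prod_erase _ (fun i => cos (κ i * x i - phase (b i))) (Finset.mem_univ j)] at h
  exact h

lemma conj_mode (x : Fin d → ℝ) : conj (mode κ b x) = mode (star κ) b x := by
  simp [mode, ← cos_conj]

lemma conj_partialDeriv_mode (j : Fin d) (x : Fin d → ℝ) :
    conj (partialDeriv j (mode κ b) x) = partialDeriv j (mode (star κ) b) x := by
  simp [partialDeriv_mode, ← cos_conj, ← sin_conj]

variable {κ b}

lemma robin_endpoint {b : Bool} {k : ℂ} {l : ℝ} (hl : l ≠ 0) (h : charFn b (α * l) (k * l) = 0) :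
    k * sin (k * l - phase b) = α * cos (k * l - phase b) := by
  apply mul_right_cancel₀ (ofReal_ne_zero.2 hl)
  rw [charFn] at h
  linear_combination h

lemma IsRoot.partialDeriv_mode_eq (h : IsRoot a α κ b) {j : Fin d} (hj : a j ≠ 0)
    {x : Fin d → ℝ} (hx : x j = a j) : partialDeriv j (mode κ b) x = -α * mode κ b x := by
  rw [partialDeriv_mode, hx, robin_endpoint hj (h j), mode,
    ← Finset.mul_prod_erase _ _ (Finset.mem_univ j), hx]
  ring

lemma IsRoot.partialDeriv_mode_eq_of_eq_neg (h : IsRoot a α κ b) {j : Fin d} (hj : a j ≠ 0)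
    {x : Fin d → ℝ} (hx : x j = -a j) : partialDeriv j (mode κ b) x = α * mode κ b x := by
  rw [partialDeriv_mode, mode, ← Finset.mul_prod_erase _ _ (Finset.mem_univ j), hx, ofReal_neg,
    mul_neg, sin_neg_sub_phase, cos_neg_sub_phase]
  linear_combination paritySign (b j) *
    (∏ i ∈ Finset.univ.erase j, cos (κ i * x i - phase (b i))) * robin_endpoint hj (h j)

lemma ae_faceMeasure_eq (a : Fin d → ℝ) (j : Fin d) (c : ℝ) :
    ∀ᵐ x ∂(faceMeasure a j c), x j = c := by
  refine Measure.tendsto_eval_ae_ae.eventually (p := fun t => t = c) ?_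
  rw [Function.update_self]
  exact (ae_dirac_iff (measurableSet_singleton c)).2 rfl

lemma IsRoot.integral_faceMeasure_sub (h : IsRoot a α κ b) {j : Fin d} (hj : a j ≠ 0)
    (f : (Fin d → ℝ) → ℂ) :
    ∫ x, partialDeriv j (mode κ b) x * f x ∂(faceMeasure a j (a j)) -
      ∫ x, partialDeriv j (mode κ b) x * f x ∂(faceMeasure a j (-a j)) =
      -α * (∫ x, mode κ b x * f x ∂(faceMeasure a j (-a j)) +
        ∫ x, mode κ b x * f x ∂(faceMeasure a j (a j))) := by
  rw [mul_add, ← integral_const_mul, ← integral_const_mul, sub_eq_neg_add, ← integral_neg]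
  congr 1 <;> refine integral_congr_ae ?_
  · filter_upwards [ae_faceMeasure_eq a j (-a j)] with x hx
    rw [h.partialDeriv_mode_eq_of_eq_neg hj hx]
    ring
  · filter_upwards [ae_faceMeasure_eq a j (a j)] with x hx
    rw [h.partialDeriv_mode_eq hj hx]
    ring

variable (κ b) in
lemma partialDeriv_partialDeriv_mode_mul {f : (Fin d → ℝ) → ℂ} (hf : Differentiable ℝ f)
    (j : Fin d) (x : Fin d → ℝ) :
    partialDeriv j (fun y => partialDeriv j (mode κ b) y * f y) x =
      partialDeriv j (mode κ b) x * partialDeriv j f x - κ j ^ 2 * (mode κ b x * f x) := by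
  have hw := (contDiff_partialDeriv j (contDiff_mode κ b)).differentiable (by simp) x
  rw [partialDeriv, fderiv_fun_mul hw (hf x), add_apply, smul_apply, smul_apply]
  change _ * partialDeriv j f x + f x * partialDeriv j (partialDeriv j (mode κ b)) x = _
  rw [partialDeriv_partialDeriv_mode]
  ring

lemma IsRoot.green_mode (ha : ∀ i, 0 < a i) (h : IsRoot a α κ b) {f : (Fin d → ℝ) → ℂ}
    (hf : ContDiff ℝ 1 f) :
    ∑ j, ∫ x, partialDeriv j (mode κ b) x * partialDeriv j f x ∂(boxMeasure a) +
      α * ∫ x, mode κ b x * f x ∂(surfaceMeasure a) =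
      (∑ j, κ j ^ 2) * ∫ x, mode κ b x * f x ∂(boxMeasure a) := by
  have hw (j : Fin d) : ContDiff ℝ 1 (partialDeriv j (mode κ b)) :=
    (contDiff_partialDeriv j (contDiff_mode κ b)).of_le (by simp)
  have hwf : Continuous fun x => mode κ b x * f x :=
    (contDiff_mode κ b).continuous.mul hf.continuous
  have hgrad (j : Fin d) :
      Integrable (fun x => partialDeriv j (mode κ b) x * partialDeriv j f x) (boxMeasure a) :=
    integrable_boxMeasure ((hw j).continuous.mul (continuous_partialDeriv j hf))
  have hmass (j : Fin d) : Integrable (fun x => κ j ^ 2 * (mode κ b x * f x)) (boxMeasure a) :=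
    (integrable_boxMeasure hwf).const_mul _
  have hgreen := integral_divergence_boxMeasure (fun i => (ha i).le) fun j => (hw j).mul hf
  simp only [partialDeriv_partialDeriv_mode_mul κ b (hf.differentiable one_ne_zero),
    h.integral_faceMeasure_sub (ha _).ne', Finset.sum_sub_distrib] at hgreen
  rw [integral_sub (integrable_finsetSum _ fun j _ => hgrad j)
      (integrable_finsetSum _ fun j _ => hmass j), integral_finsetSum _ fun j _ => hgrad j,
    integral_finsetSum _ fun j _ => hmass j, ← Finset.mul_sum, ← integral_surfaceMeasure hwf]
    at hgreen
  simp only [integral_const_mul, ← Finset.sum_mul] at hgreen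
  linear_combination hgreen

end Modes

/-! ### Modes as eigenfunctions -/

section Eigenfunctions

variable {d : ℕ} (a : Fin d → ℝ) (κ : Fin d → ℂ) (b : Fin d → Bool)

/-- A mode as an element of `L²` of the box. -/
def modeLp : L2Box a :=
  (memLp_of_ae_mem_isCompact isCompact_Icc (ae_boxMeasure_mem_Icc a)
    (contDiff_mode κ b).continuous 2).toLp (mode κ b)

/-- The gradient of a mode, with components in `L²` of the box. -/
def modeGrad (i : Fin d) : L2Box a :=
  (memLp_of_ae_mem_isCompact isCompact_Icc (ae_boxMeasure_mem_Icc a)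
    (contDiff_partialDeriv i (contDiff_mode κ b)).continuous 2).toLp (partialDeriv i (mode κ b))

/-- The boundary values of a mode, as an element of `L²` of the boundary. -/
def modeTrace : L2Bdry a :=
  (memLp_of_ae_mem_isCompact isCompact_Icc (ae_surfaceMeasure_mem_Icc a)
    (contDiff_mode κ b).continuous 2).toLp (mode κ b)

lemma coeFn_modeLp : modeLp a κ b =ᵐ[boxMeasure a] mode κ b := MemLp.coeFn_toLp _

lemma coeFn_modeGrad (i : Fin d) :
    modeGrad a κ b i =ᵐ[boxMeasure a] partialDeriv i (mode κ b) := MemLp.coeFn_toLp _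

lemma coeFn_modeTrace : modeTrace a κ b =ᵐ[surfaceMeasure a] mode κ b := MemLp.coeFn_toLp _

lemma hasGradientAndTrace_modeLp :
    HasGradientAndTrace a (modeLp a κ b) (modeGrad a κ b) (modeTrace a κ b) :=
  ⟨hasWeakGradient_of_contDiff ((contDiff_mode κ b).of_le (by simp)) (coeFn_modeLp a κ b)
      (coeFn_modeGrad a κ b),
    subset_closure ⟨mode κ b, contDiff_mode κ b, coeFn_modeLp a κ b, coeFn_modeGrad a κ b,
      coeFn_modeTrace a κ b⟩⟩

variable {a κ b} {α μ : ℂ}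

lemma IsRoot.green_form (ha : ∀ i, 0 < a i) (h : IsRoot a α κ b) {u : L2Box a}
    {G : Fin d → L2Box a} {g : L2Bdry a} (hu : HasGradientAndTrace a u G g) :
    ∑ i, inner ℂ (modeGrad a (star κ) b i) (G i) + α * inner ℂ (modeTrace a (star κ) b) g =
      (∑ i, κ i ^ 2) * inner ℂ (modeLp a (star κ) b) u := by
  have hclosed : IsClosed {p : L2Box a × (Fin d → L2Box a) × L2Bdry a |
      ∑ i, inner ℂ (modeGrad a (star κ) b i) (p.2.1 i) +
        α * inner ℂ (modeTrace a (star κ) b) p.2.2 =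
      (∑ i, κ i ^ 2) * inner ℂ (modeLp a (star κ) b) p.1} :=
    isClosed_eq (by fun_prop) (by fun_prop)
  refine hclosed.closure_subset_iff.2 ?_ hu.2
  rintro p ⟨f, hf, hp, hgrad, htrace⟩
  rw [Set.mem_ofPred_eq, inner_eq_integral (coeFn_modeLp a _ b) hp,
    inner_eq_integral (coeFn_modeTrace a _ b) htrace,
    Finset.sum_congr rfl fun i _ => inner_eq_integral (coeFn_modeGrad a _ b i) (hgrad i)]
  simpa only [conj_mode, conj_partialDeriv_mode, star_star] using
    h.green_mode ha (hf.of_le (by simp))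

lemma IsRoot.inner_of_mem_robinLaplacian (ha : ∀ i, 0 < a i) (h : IsRoot a α κ b)
    {u f : L2Box a} (hu : (u, f) ∈ robinLaplacian a α) :
    inner ℂ (modeLp a (star κ) b) f = (∑ i, κ i ^ 2) * inner ℂ (modeLp a (star κ) b) u := by
  obtain ⟨G, g, hG, hform⟩ := hu
  rw [← h.green_form ha hG]
  exact (hform _ _ _ (hasGradientAndTrace_modeLp a _ b)).symm

lemma IsRoot.modeLp_mem_robinLaplacian (ha : ∀ i, 0 < a i) (h : IsRoot a α κ b) :
    (modeLp a κ b, (∑ i, κ i ^ 2) • modeLp a κ b) ∈ robinLaplacian a α := by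
  refine ⟨_, _, hasGradientAndTrace_modeLp a κ b, fun v H k hv => ?_⟩
  have hgreen := congrArg (starRingEnd ℂ) (h.conj.green_form ha hv)
  simp only [map_add, map_sum, map_mul, map_pow, conj_conj, inner_conj_symm, star_star,
    Pi.star_apply, RCLike.star_def] at hgreen
  rw [inner_smul_right, ← hgreen]

lemma IsRoot.inner_eq_zero_of_mem_kerPow (ha : ∀ i, 0 < a i) (h : IsRoot a α κ b)
    (hμ : ∑ i, κ i ^ 2 ≠ μ) {n : ℕ} {u : L2Box a} (hu : u ∈ kerPow a α μ n) :
    inner ℂ (modeLp a (star κ) b) u = 0 := by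
  induction n generalizing u with
  | zero => rw [(Submodule.mem_bot ℂ).1 hu, inner_zero_right]
  | succ n ih =>
    obtain ⟨⟨v, f⟩, ⟨hv, hf⟩, rfl⟩ := hu
    have hpow := ih hf
    simp only [LinearMap.sub_apply, LinearMap.smul_apply, LinearMap.snd_apply, LinearMap.fst_apply,
      inner_sub_right, inner_smul_right, h.inner_of_mem_robinLaplacian ha hv, ← sub_mul] at hpow ⊢
    exact (mul_eq_zero.1 hpow).resolve_left (sub_ne_zero.2 hμ)

lemma kerPow_mono (a : Fin d → ℝ) (α μ : ℂ) : Monotone (kerPow a α μ) := by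
  refine monotone_nat_of_le_succ fun n => ?_
  induction n with
  | zero => exact bot_le
  | succ n ih => exact Submodule.map_mono (inf_le_inf_left _ (Submodule.comap_mono ih))

lemma IsRoot.inner_eq_zero_of_mem_iSup_kerPow (ha : ∀ i, 0 < a i) (h : IsRoot a α κ b)
    (hμ : ∑ i, κ i ^ 2 ≠ μ) {u : L2Box a} (hu : u ∈ ⨆ n, kerPow a α μ n) :
    inner ℂ (modeLp a (star κ) b) u = 0 := by
  rw [Submodule.mem_iSup_of_directed _ (kerPow_mono a α μ).directed_le] at hu
  obtain ⟨n, hn⟩ := hu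
  exact h.inner_eq_zero_of_mem_kerPow ha hμ hn

lemma mem_iSup_kerPow {u : L2Box a} (hu : (u, μ • u) ∈ robinLaplacian a α) :
    u ∈ ⨆ n, kerPow a α μ n :=
  Submodule.mem_iSup_of_mem 1 ⟨(u, μ • u), ⟨hu, by simp [kerPow]⟩, rfl⟩

end Eigenfunctions

/-! ### Zeros and growth of the characteristic function -/

lemma norm_sin_sq (z : ℂ) : ‖sin z‖ ^ 2 = Real.sin z.re ^ 2 + Real.sinh z.im ^ 2 := by
  rw [← normSq_eq_norm_sq, normSq_apply, sin_eq]
  simp only [← ofReal_sin, ← ofReal_cos, ← ofReal_sinh, ← ofReal_cosh, ← ofReal_mul, add_re,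
    add_im, ofReal_re, ofReal_im, re_ofReal_mul, im_ofReal_mul, I_re, I_im, mul_zero, mul_one,
    zero_add, add_zero]
  linear_combination Real.sin z.re ^ 2 * Real.cosh_sq z.im +
    Real.sinh z.im ^ 2 * Real.sin_sq_add_cos_sq z.re

lemma norm_cos_sq (z : ℂ) : ‖cos z‖ ^ 2 = Real.cos z.re ^ 2 + Real.sinh z.im ^ 2 := by
  rw [← sin_add_pi_div_two, norm_sin_sq, ← ofReal_ofNat, ← ofReal_div, add_re, add_im,
    ofReal_re, ofReal_im, add_zero, Real.sin_add_pi_div_two]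

lemma norm_cos_le_cosh (z : ℂ) : ‖cos z‖ ≤ Real.cosh z.im := by
  refine (sq_le_sq₀ (norm_nonneg _) (Real.cosh_pos _).le).1 ?_
  rw [norm_cos_sq, Real.cosh_sq]
  linarith [Real.cos_sq_le_one z.re]

lemma norm_sin_le_cosh (z : ℂ) : ‖sin z‖ ≤ Real.cosh z.im := by
  have h := norm_cos_le_cosh (z - (π / 2 : ℝ))
  rwa [sub_im, ofReal_im, sub_zero, ofReal_div, ofReal_ofNat, cos_sub_pi_div_two] at h

lemma abs_sinh_le_norm_sin (z : ℂ) : |Real.sinh z.im| ≤ ‖sin z‖ := by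
  refine (sq_le_sq₀ (abs_nonneg _) (norm_nonneg _)).1 ?_
  rw [sq_abs, norm_sin_sq]
  linarith [sq_nonneg (Real.sin z.re)]

lemma abs_le_abs_sinh (x : ℝ) : |x| ≤ |Real.sinh x| := by
  rw [Real.abs_sinh]
  exact Real.self_le_sinh_iff.2 (abs_nonneg x)

lemma cosh_le_two_mul_abs_sinh {x : ℝ} (hx : 1 ≤ |x|) : Real.cosh x ≤ 2 * |Real.sinh x| := by
  have hsinh : 1 ≤ |Real.sinh x| := hx.trans (abs_le_abs_sinh x)
  refine (sq_le_sq₀ (Real.cosh_pos _).le (by positivity)).1 ?_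
  rw [mul_pow, sq_abs, Real.cosh_sq]
  linarith [sq_abs (Real.sinh x), one_le_pow₀ hsinh (n := 2)]

lemma differentiable_charFn (b : Bool) (A : ℂ) : Differentiable ℂ (charFn b A) := by
  unfold charFn
  fun_prop

lemma hasDerivAt_charFn (b : Bool) (A z : ℂ) :
    HasDerivAt (charFn b A) ((1 + A) * sin (z - phase b) + z * cos (z - phase b)) z := by
  have hsub : HasDerivAt (fun z : ℂ => z - phase b) 1 z := (hasDerivAt_id' z).sub_const _
  exact (((hasDerivAt_id' z).mul hsub.csin).sub (hsub.ccos.const_mul A)).congr_deriv (by ring)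

lemma sq_eq_of_double_zero_charFn {b : Bool} {A z : ℂ} (hA : A ≠ 0) (hzero : charFn b A z = 0)
    (hderiv : (1 + A) * sin (z - phase b) + z * cos (z - phase b) = 0) :
    z ^ 2 = -(A * (1 + A)) ∧ sin (z - phase b) ^ 2 = -A := by
  rw [charFn] at hzero
  set S := sin (z - phase b)
  set C := cos (z - phase b)
  have hSC : S ^ 2 + C ^ 2 = 1 := sin_sq_add_cos_sq _
  have hz : z ^ 2 = -(A * (1 + A)) := by
    linear_combination -(z ^ 2 + A * (1 + A)) * hSC + S * (z * hzero + A * hderiv) +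
      C * (z * hderiv - (1 + A) * hzero)
  refine ⟨hz, mul_left_cancel₀ hA ?_⟩
  linear_combination -(z * S + A * C) * hzero + S ^ 2 * hz - A ^ 2 * hSC

lemma two_mul_im_sq (z : ℂ) : 2 * z.im ^ 2 = ‖z ^ 2‖ - (z ^ 2).re := by
  rw [norm_pow, ← normSq_eq_norm_sq, normSq_apply, pow_two z, mul_re]
  ring

-- At a double zero `2 (im z)² = ‖A (1 + A)‖ + re (A (1 + A))` exceeds `2 sinh² (im z) ≤ 2 ‖A‖`.
lemma deriv_charFn_ne_zero {b : Bool} {A z : ℂ} (hA : 2 * ‖A‖ < A.re ^ 2)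
    (hzero : charFn b A z = 0) : deriv (charFn b A) z ≠ 0 := by
  rw [(hasDerivAt_charFn b A z).deriv]
  intro hderiv
  have hA0 : A ≠ 0 := by rintro rfl; simp at hA
  obtain ⟨hz, hsin⟩ := sq_eq_of_double_zero_charFn hA0 hzero hderiv
  have him_le : z.im ^ 2 ≤ ‖A‖ := calc
    z.im ^ 2 ≤ Real.sinh z.im ^ 2 := sq_le_sq.2 (abs_le_abs_sinh z.im)
    _ = |Real.sinh (z - phase b).im| ^ 2 := by rw [sub_im, ofReal_im, sub_zero, sq_abs]
    _ ≤ ‖sin (z - phase b)‖ ^ 2 := by gcongr; exact abs_sinh_le_norm_sin _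
    _ = ‖A‖ := by rw [← norm_pow, hsin, norm_neg]
  have him_eq : 2 * z.im ^ 2 = ‖A‖ * ‖1 + A‖ + (A * (1 + A)).re := by
    rw [two_mul_im_sq, hz, norm_neg, norm_mul, neg_re, sub_neg_eq_add]
  have hone_add : ‖A‖ - 1 ≤ ‖1 + A‖ := by
    simpa [add_comm] using norm_sub_norm_le A (-1)
  have hnorm_sq : ‖A‖ ^ 2 = A.re ^ 2 + A.im ^ 2 := by
    rw [← normSq_eq_norm_sq, normSq_apply]
    ring
  have hre : -‖A‖ ≤ A.re := (abs_le.1 (abs_re_le_norm A)).1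
  simp only [mul_re, add_re, one_re, add_im, one_im] at him_eq
  nlinarith [norm_nonneg A]

lemma exists_eq_mul_of_simple_zeros {F G : ℂ → ℂ} (hF : Differentiable ℂ F)
    (hG : Differentiable ℂ G) (hsimple : ∀ z, F z = 0 → deriv F z ≠ 0)
    (hFG : ∀ z, F z = 0 → G z = 0) :
    ∃ Φ : ℂ → ℂ, Differentiable ℂ Φ ∧ ∀ z, G z = Φ z * F z := by
  classical
  refine ⟨fun z => if F z = 0 then deriv G z / deriv F z else G z / F z, fun z => ?_, fun z => ?_⟩
  · by_cases hz : F z = 0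
    · have hdslope {H : ℂ → ℂ} (hH : Differentiable ℂ H) : Differentiable ℂ (dslope H z) :=
        differentiableOn_univ.1
          ((differentiableOn_dslope univ_mem).2 hH.differentiableOn)
      have hne : dslope F z z ≠ 0 := by rw [dslope_same]; exact hsimple z hz
      refine ((hdslope hG z).div (hdslope hF z) hne).congr_of_eventuallyEq ?_
      filter_upwards [(hdslope hF z).continuousAt.eventually_ne hne] with w hw
      rcases eq_or_ne w z with rfl | hwz
      · simp [hz, dslope_same]
      · rw [dslope_of_ne _ hwz, slope_def_field, hz, sub_zero] at hw
        have hFw : F w ≠ 0 := fun h => hw (by rw [h, zero_div])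
        rw [if_neg hFw, Pi.div_apply, dslope_of_ne _ hwz, dslope_of_ne _ hwz, slope_def_field,
          slope_def_field, hz, hFG z hz, sub_zero, sub_zero,
          div_div_div_cancel_right₀ (sub_ne_zero.2 hwz)]
    · refine ((hG z).div (hF z) hz).congr_of_eventuallyEq ?_
      filter_upwards [(hF z).continuousAt.eventually_ne hz] with w hw
      simp [hw]
  · by_cases hz : F z = 0
    · simp [hz, hFG z hz]
    · simp [hz]

-- The maximum principle applied to the entire quotient `G / F`.
lemma eq_zero_of_simple_zeros {F G : ℂ → ℂ} (hF : Differentiable ℂ F)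
    (hG : Differentiable ℂ G) (hsimple : ∀ z, F z = 0 → deriv F z ≠ 0)
    (hFG : ∀ z, F z = 0 → G z = 0)
    (hcontour : ∀ ε > 0, ∀ z₀ : ℂ, ∃ U : Set ℂ, IsBounded U ∧ z₀ ∈ U ∧
      ∀ z ∈ frontier U, F z ≠ 0 ∧ ‖G z‖ ≤ ε * ‖F z‖) (z : ℂ) : G z = 0 := by
  obtain ⟨Φ, hΦ, hGΦ⟩ := exists_eq_mul_of_simple_zeros hF hG hsimple hFG
  suffices hz : Φ z = 0 by rw [hGΦ, hz, zero_mul]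
  refine norm_le_zero_iff.1 (le_of_forall_pos_le_add fun ε hε => ?_)
  obtain ⟨U, hU, hzU, hfrontier⟩ := hcontour ε hε z
  rw [zero_add]
  refine norm_le_of_forall_mem_frontier_norm_le hU hΦ.diffContOnCl (fun w hw => ?_)
    (subset_closure hzU)
  obtain ⟨hFw, hle⟩ := hfrontier w hw
  rw [hGΦ, norm_mul] at hle
  exact le_of_mul_le_mul_right hle (norm_pos_iff.2 hFw)

lemma mul_cosh_le_norm_charFn {b : Bool} {A z : ℂ} {M : ℝ} (hz : 2 * (M + ‖A‖) ≤ ‖z‖)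
    (hsin : Real.cosh z.im ≤ 2 * ‖sin (z - phase b)‖) : M * Real.cosh z.im ≤ ‖charFn b A z‖ := by
  have hcos : ‖cos (z - phase b)‖ ≤ Real.cosh z.im := by
    simpa using norm_cos_le_cosh (z - phase b)
  calc M * Real.cosh z.im ≤ (‖z‖ / 2 - ‖A‖) * Real.cosh z.im := by
        gcongr
        linarith
    _ = ‖z‖ * (Real.cosh z.im / 2) - ‖A‖ * Real.cosh z.im := by ring
    _ ≤ ‖z‖ * ‖sin (z - phase b)‖ - ‖A‖ * ‖cos (z - phase b)‖ := by
        gcongr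
        linarith
    _ ≤ ‖charFn b A z‖ := by
        rw [← norm_mul, ← norm_mul]
        exact norm_sub_norm_le _ _

lemma cosh_le_two_mul_norm_sin_of_one_le_im (b : Bool) {z : ℂ} (hz : 1 ≤ |z.im|) :
    Real.cosh z.im ≤ 2 * ‖sin (z - phase b)‖ := by
  refine (cosh_le_two_mul_abs_sinh hz).trans ?_
  gcongr
  simpa using abs_sinh_le_norm_sin (z - phase b)

lemma cosh_eq_norm_sin_of_cos_eq_zero {z : ℂ} (hz : Real.cos z.re = 0) :
    Real.cosh z.im = ‖sin z‖ := by
  refine (sq_eq_sq₀ (Real.cosh_pos _).le (norm_nonneg _)).1 ?_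
  rw [norm_sin_sq, Real.sin_sq, hz, Real.cosh_sq]
  ring

lemma cos_sub_phase_eq_zero_of_abs_eq {b : Bool} {N : ℕ} {x : ℝ}
    (hx : |x| = N * π + π / 2 + phase b) : Real.cos (x - phase b) = 0 := by
  have habs : Real.cos (|x| - phase b) = 0 := by
    rw [hx, add_sub_cancel_right, Real.cos_add_pi_div_two, Real.sin_nat_mul_pi, neg_zero]
  rcases abs_choice x with h | h
  · rwa [← h]
  · have hneg := cos_neg_sub_phase b (|x| : ℝ)
    rw [← ofReal_sub, ← ofReal_cos, habs, ofReal_zero, mul_zero, ← ofReal_neg, h, neg_neg,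
      ← ofReal_sub, ← ofReal_cos] at hneg
    exact ofReal_eq_zero.1 hneg

lemma abs_eq_of_mem_pair_neg {x R : ℝ} (hR : 0 ≤ R) (hx : x ∈ ({-R, R} : Set ℝ)) : |x| = R := by
  rcases hx with rfl | rfl
  · rw [abs_neg, abs_of_nonneg hR]
  · exact abs_of_nonneg hR

-- The vertical sides of the square pass through zeros of `cos (x - phase b)`.
lemma exists_square_charFn (b : Bool) (A : ℂ) (M : ℝ) (z₀ : ℂ) :
    ∃ U : Set ℂ, IsBounded U ∧ z₀ ∈ U ∧
      ∀ z ∈ frontier U, M * Real.cosh z.im ≤ ‖charFn b A z‖ := by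
  obtain ⟨N, hN⟩ := exists_nat_gt (‖z₀‖ + 2 * (|M| + ‖A‖) + 1)
  set R : ℝ := N * π + π / 2 + phase b with hR
  have hphase : 0 ≤ phase b := by cases b <;> simp [phase, Real.pi_div_two_pos.le]
  have hNR : (N : ℝ) ≤ R := by nlinarith [Real.pi_gt_three, N.cast_nonneg (α := ℝ)]
  have hlarge : 2 * (M + ‖A‖) ≤ R := by linarith [le_abs_self M, norm_nonneg z₀]
  have hz₀ : ‖z₀‖ < R := by linarith [abs_nonneg M, norm_nonneg A]
  have hone : 1 ≤ R := by linarith [abs_nonneg M, norm_nonneg A, norm_nonneg z₀]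
  refine ⟨Set.Ioo (-R) R ×ℂ Set.Ioo (-R) R,
    (Metric.isBounded_Ioo _ _).reProdIm (Metric.isBounded_Ioo _ _),
    ⟨abs_lt.1 ((abs_re_le_norm z₀).trans_lt hz₀), abs_lt.1 ((abs_im_le_norm z₀).trans_lt hz₀)⟩,
    fun z hz => ?_⟩
  rw [frontier_reProdIm, frontier_Ioo (by linarith)] at hz
  rcases hz with ⟨-, him⟩ | ⟨hre, -⟩
  · have him : |z.im| = R := abs_eq_of_mem_pair_neg (by linarith) him
    exact mul_cosh_le_norm_charFn (hlarge.trans (him ▸ abs_im_le_norm z))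
      (cosh_le_two_mul_norm_sin_of_one_le_im b (him ▸ hone))
  · have hre : |z.re| = R := abs_eq_of_mem_pair_neg (by linarith) hre
    refine mul_cosh_le_norm_charFn (hlarge.trans (hre ▸ abs_re_le_norm z)) ?_
    have hcos : Real.cos (z - phase b).re = 0 := cos_sub_phase_eq_zero_of_abs_eq hre
    have hsin := cosh_eq_norm_sin_of_cos_eq_zero hcos
    rw [sub_im, ofReal_im, sub_zero] at hsin
    linarith [norm_nonneg (sin (z - phase b))]

lemma eq_zero_of_zeros_charFn {b : Bool} {A : ℂ} (hA : 2 * ‖A‖ < A.re ^ 2) {G : ℂ → ℂ}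
    (hG : Differentiable ℂ G) {M : ℝ} (hM : ∀ z, ‖G z‖ ≤ M * Real.cosh z.im)
    (hzeros : ∀ z, charFn b A z = 0 → G z = 0) (z : ℂ) : G z = 0 := by
  refine eq_zero_of_simple_zeros (differentiable_charFn b A) hG
    (fun w hw => deriv_charFn_ne_zero hA hw) hzeros (fun ε hε z₀ => ?_) z
  obtain ⟨U, hU, hz₀U, hfrontier⟩ := exists_square_charFn b A (|M| / ε + 1) z₀
  refine ⟨U, hU, hz₀U, fun w hw => ?_⟩
  refine ⟨norm_pos_iff.1 ((by positivity : 0 < (|M| / ε + 1) * Real.cosh w.im).trans_le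
    (hfrontier w hw)), ?_⟩
  calc ‖G w‖ ≤ |M| * Real.cosh w.im := (hM w).trans (by gcongr; exact le_abs_self M)
    _ = ε * (|M| / ε * Real.cosh w.im) := by field_simp
    _ ≤ ε * ((|M| / ε + 1) * Real.cosh w.im) := by gcongr; linarith
    _ ≤ ε * ‖charFn b A w‖ := by gcongr; exact hfrontier w hw

/-! ### Completeness of the modes -/

section CosineTransform

variable {X : Type*} [MeasurableSpace X] {μ : Measure X} {V : X → ℂ} {τ : X → ℝ}

lemma cosh_mul_le {t y r : ℝ} (ht : |t| ≤ 1) (hy : |y| ≤ r) : Real.cosh (t * y) ≤ Real.cosh r := by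
  rw [Real.cosh_le_cosh, abs_mul, abs_of_nonneg ((abs_nonneg y).trans hy)]
  calc |t| * |y| ≤ 1 * |y| := by gcongr
    _ ≤ r := by rwa [one_mul]

lemma im_mul_ofReal_sub_ofReal (z : ℂ) (t θ : ℝ) : (z * t - θ).im = t * z.im := by
  rw [sub_im, ofReal_im, sub_zero, im_mul_ofReal, mul_comm]

lemma norm_cos_mul_sub_le {t r : ℝ} (ht : |t| ≤ 1) {z : ℂ} (hz : |z.im| ≤ r) (θ : ℝ) :
    ‖cos (z * t - θ)‖ ≤ Real.cosh r := by
  refine (norm_cos_le_cosh _).trans ?_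
  rw [im_mul_ofReal_sub_ofReal]
  exact cosh_mul_le ht hz

lemma norm_sin_mul_sub_le {t r : ℝ} (ht : |t| ≤ 1) {z : ℂ} (hz : |z.im| ≤ r) (θ : ℝ) :
    ‖sin (z * t - θ)‖ ≤ Real.cosh r := by
  refine (norm_sin_le_cosh _).trans ?_
  rw [im_mul_ofReal_sub_ofReal]
  exact cosh_mul_le ht hz

lemma differentiable_integral_mul_cos (hV : Integrable V μ) (hτ : Measurable τ)
    (hτ1 : ∀ᵐ x ∂μ, |τ x| ≤ 1) (θ : ℝ) :
    Differentiable ℂ fun z : ℂ => ∫ x, V x * cos (z * τ x - θ) ∂μ := by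
  intro z
  have hcos (w : ℂ) : AEStronglyMeasurable (fun x => cos (w * τ x - θ)) μ := by fun_prop
  have hsin : AEStronglyMeasurable (fun x => V x * -(τ x * sin (z * τ x - θ))) μ :=
    hV.1.mul (by fun_prop)
  refine (hasDerivAt_integral_of_dominated_loc_of_deriv_le
    (F' := fun w x => V x * -(τ x * sin (w * τ x - θ)))
    (bound := fun x => ‖V x‖ * Real.cosh (|z.im| + 1)) (Metric.ball_mem_nhds z one_pos)
    (Eventually.of_forall fun w => hV.1.mul (hcos w)) ?_ hsin ?_ (hV.norm.mul_const _) ?_).2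
    |>.differentiableAt
  · exact hV.mul_bdd (hcos z) (hτ1.mono fun x hx => norm_cos_mul_sub_le hx le_rfl θ)
  · filter_upwards [hτ1] with x hx w hw
    have him : |w.im| ≤ |z.im| + 1 := by
      have hsub : |(w - z).im| ≤ 1 := (abs_im_le_norm _).trans (mem_ball_iff_norm.1 hw).le
      rw [sub_im] at hsub
      linarith [abs_sub_abs_le_abs_sub w.im z.im]
    rw [norm_mul, norm_neg, norm_mul, norm_real, Real.norm_eq_abs]
    gcongr
    exact (mul_le_of_le_one_left (norm_nonneg _) hx).trans (norm_sin_mul_sub_le hx him θ)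
  · refine Eventually.of_forall fun x w _ => ?_
    have harg : HasDerivAt (fun w : ℂ => w * τ x - θ) (τ x : ℂ) w := by
      simpa only [one_mul] using ((hasDerivAt_id' w).mul_const (τ x : ℂ)).sub_const (θ : ℂ)
    exact (harg.ccos.const_mul (V x)).congr_deriv (by ring)

lemma norm_integral_mul_cos_le (hV : Integrable V μ) (hτ1 : ∀ᵐ x ∂μ, |τ x| ≤ 1) (θ : ℝ) (z : ℂ) :
    ‖∫ x, V x * cos (z * τ x - θ) ∂μ‖ ≤ (∫ x, ‖V x‖ ∂μ) * Real.cosh z.im := by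
  rw [← integral_mul_const]
  refine norm_integral_le_of_norm_le (hV.norm.mul_const _) ?_
  filter_upwards [hτ1] with x hx
  rw [norm_mul, ← Real.cosh_abs z.im]
  gcongr
  exact norm_cos_mul_sub_le hx le_rfl θ

end CosineTransform

section ModeIntegrals

variable {d : ℕ} {a : Fin d → ℝ} {α : ℂ} {V : (Fin d → ℝ) → ℂ}

lemma integrable_mul_boxMeasure (hV : Integrable V (boxMeasure a)) {f : (Fin d → ℝ) → ℂ}
    (hf : Continuous f) : Integrable (fun x => V x * f x) (boxMeasure a) :=
  hV.mul_of_top_left (memLp_of_ae_mem_isCompact isCompact_Icc (ae_boxMeasure_mem_Icc a) hf ⊤)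

lemma mode_update (κ : Fin d → ℂ) (b : Fin d → Bool) (j : Fin d) (k : ℂ) (x : Fin d → ℝ) :
    mode (Function.update κ j k) b x =
      (∏ i ∈ Finset.univ.erase j, cos (κ i * x i - phase (b i))) *
        cos (k * x j - phase (b j)) := by
  rw [mode, ← Finset.prod_erase_mul _ _ (Finset.mem_univ j), Function.update_self]
  congr 1
  refine Finset.prod_congr rfl fun i hi => ?_
  rw [Function.update_of_ne (Finset.ne_of_mem_erase hi)]

lemma integral_mul_mode_eq_zero_of_update {j : Fin d} (ha : 0 < a j) {A : ℂ}
    (hA : 2 * ‖A‖ < A.re ^ 2) (hV : Integrable V (boxMeasure a)) {κ : Fin d → ℂ}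
    {b : Fin d → Bool}
    (h : ∀ k, charFn (b j) A (k * a j) = 0 →
      ∫ x, V x * mode (Function.update κ j k) b x ∂(boxMeasure a) = 0) :
    ∫ x, V x * mode κ b x ∂(boxMeasure a) = 0 := by
  have haj : (a j : ℂ) ≠ 0 := ofReal_ne_zero.2 ha.ne'
  set W : (Fin d → ℝ) → ℂ := fun x =>
    V x * ∏ i ∈ Finset.univ.erase j, cos (κ i * x i - phase (b i))
  have hW : Integrable W (boxMeasure a) := integrable_mul_boxMeasure hV (by fun_prop)
  have hscaled : ∀ᵐ x ∂(boxMeasure a), |x j / a j| ≤ 1 := by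
    filter_upwards [ae_boxMeasure_mem_Icc a] with x hx
    rw [abs_div, abs_of_pos ha, div_le_one ha, abs_le]
    exact ⟨hx.1 j, hx.2 j⟩
  have htransform (k : ℂ) : ∫ x, W x * cos (k * a j * (x j / a j : ℝ) - phase (b j))
      ∂(boxMeasure a) = ∫ x, V x * mode (Function.update κ j k) b x ∂(boxMeasure a) := by
    refine integral_congr_ae (Eventually.of_forall fun x => ?_)
    simp only [W, mode_update, mul_assoc, ofReal_div, mul_div_cancel₀ _ haj]
  have hzero := eq_zero_of_zeros_charFn hA
    (differentiable_integral_mul_cos hW (by fun_prop) hscaled (phase (b j)))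
    (norm_integral_mul_cos_le hW hscaled (phase (b j)))
    (fun z hz => by
      rw [← div_mul_cancel₀ z haj] at hz ⊢
      rw [htransform, h _ hz]) (κ j * a j)
  rwa [htransform, Function.update_eq_self] at hzero

-- The frequencies are released from the characteristic equations one coordinate at a time.
lemma integral_mul_mode_eq_zero (ha : ∀ i, 0 < a i)
    (hα : ∀ i, 2 * ‖α * a i‖ < (α * a i).re ^ 2) (hV : Integrable V (boxMeasure a))
    (h : ∀ κ b, IsRoot a α κ b → ∫ x, V x * mode κ b x ∂(boxMeasure a) = 0)
    (κ : Fin d → ℂ) (b : Fin d → Bool) : ∫ x, V x * mode κ b x ∂(boxMeasure a) = 0 := by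
  suffices hs : ∀ s : Finset (Fin d), ∀ κ, (∀ i ∉ s, charFn (b i) (α * a i) (κ i * a i) = 0) →
      ∫ x, V x * mode κ b x ∂(boxMeasure a) = 0 from
    hs Finset.univ κ fun i hi => absurd (Finset.mem_univ i) hi
  intro s
  induction s using Finset.induction_on with
  | empty => exact fun κ hroot => h κ b fun i => hroot i (Finset.notMem_empty i)
  | insert j s _ ih =>
    refine fun κ hroot => integral_mul_mode_eq_zero_of_update (ha j) (hα j) hV fun k hk =>
      ih _ fun i hi => ?_
    rcases eq_or_ne i j with rfl | hij
    · rwa [Function.update_self]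
    · rw [Function.update_of_ne hij]
      exact hroot i fun hmem => (Finset.mem_insert.1 hmem).elim hij hi

lemma exp_mul_I_eq_sum_cos (w : ℂ) :
    exp (w * I) = ∑ c : Bool, (if c then I else 1) * cos (w - phase c) := by
  simp only [exp_mul_I, phase, Fintype.sum_bool, Bool.false_eq_true, if_true, if_false, ofReal_div,
    ofReal_ofNat, cos_sub_pi_div_two, ofReal_zero, sub_zero]
  ring

lemma exp_sum_mul_I_eq_sum_mode (ξ x : Fin d → ℝ) : exp ((∑ i, ξ i * x i : ℝ) * I) =
    ∑ c : Fin d → Bool, (∏ i, if c i then I else 1) * mode (fun i => (ξ i : ℂ)) c x := by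
  push_cast
  rw [Finset.sum_mul, exp_sum]
  simp only [exp_mul_I_eq_sum_cos, Fintype.prod_sum, Finset.prod_mul_distrib, mode]

lemma integral_mul_exp_eq_zero (hV : Integrable V (boxMeasure a))
    (h : ∀ κ b, ∫ x, V x * mode κ b x ∂(boxMeasure a) = 0) (ξ : Fin d → ℝ) :
    ∫ x, V x * exp ((∑ i, ξ i * x i : ℝ) * I) ∂(boxMeasure a) = 0 := by
  simp only [exp_sum_mul_I_eq_sum_mode, Finset.mul_sum, mul_left_comm (V _)]
  rw [integral_finsetSum]
  · exact Finset.sum_eq_zero fun c _ => by rw [integral_const_mul, h, mul_zero]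
  · exact fun c _ => (integrable_mul_boxMeasure hV (contDiff_mode _ c).continuous).const_mul _

end ModeIntegrals

section FourierUniqueness

variable {E : Type*} [NormedAddCommGroup E] [NormedSpace ℝ E] [MeasurableSpace E]
  {μ : Measure E}

lemma integrable_mul_exp_dual [BorelSpace E] [SecondCountableTopology E] {v : E → ℂ}
    (hv : Integrable v μ) (L : StrongDual ℝ E) :
    Integrable (fun x => v x * exp (L x * I)) μ :=
  hv.mul_bdd (c := 1)
    (by fun_prop : Continuous fun x => exp (L x * I)).aestronglyMeasurable
    (Eventually.of_forall fun x => (norm_exp_ofReal_mul_I _).le)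

lemma charFunDual_withDensity_ofReal {v : E → ℝ} (hv : AEMeasurable v μ) (L : StrongDual ℝ E) :
    charFunDual (μ.withDensity fun x => ENNReal.ofReal (v x)) L =
      ∫ x, ((max (v x) 0 : ℝ) : ℂ) * exp (L x * I) ∂μ := by
  rw [charFunDual_apply, integral_withDensity_eq_integral_toReal_smul₀ hv.ennreal_ofReal
    (Eventually.of_forall fun _ => ENNReal.ofReal_lt_top)]
  simp only [ENNReal.toReal_ofReal', real_smul]

variable [BorelSpace E] [SecondCountableTopology E] [CompleteSpace E]

-- The positive and negative parts of `v` are densities of measures with equal characteristic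
-- functions.
lemma ae_eq_zero_of_integral_ofReal_mul_exp_eq_zero {v : E → ℝ} (hv : Integrable v μ)
    (h : ∀ L : StrongDual ℝ E, ∫ x, (v x : ℂ) * exp (L x * I) ∂μ = 0) : v =ᵐ[μ] 0 := by
  have hpos : Integrable (fun x => ((max (v x) 0 : ℝ) : ℂ)) μ := hv.pos_part.ofReal
  have hneg : Integrable (fun x => ((max (-v x) 0 : ℝ) : ℂ)) μ := hv.neg_part.ofReal
  have hfin : ∫⁻ x, ENNReal.ofReal (v x) ∂μ ≠ ⊤ := hv.lintegral_lt_top.ne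
  have := isFiniteMeasure_withDensity hfin
  have := isFiniteMeasure_withDensity hv.neg.lintegral_lt_top.ne
  have heq : μ.withDensity (fun x => ENNReal.ofReal (v x)) =
      μ.withDensity (fun x => ENNReal.ofReal (-v x)) := by
    refine Measure.ext_of_charFunDual (funext fun L => ?_)
    rw [charFunDual_withDensity_ofReal hv.aemeasurable,
      charFunDual_withDensity_ofReal hv.aemeasurable.fun_neg, ← sub_eq_zero,
      ← integral_sub (integrable_mul_exp_dual hpos L) (integrable_mul_exp_dual hneg L), ← h L]
    simp only [← sub_mul, ← ofReal_sub, max_zero_sub_max_neg_zero_eq_self]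
  rw [withDensity_eq_iff hv.aemeasurable.ennreal_ofReal hv.aemeasurable.fun_neg.ennreal_ofReal
    hfin] at heq
  filter_upwards [heq] with x hx
  have hparts := congrArg ENNReal.toReal hx
  rw [ENNReal.toReal_ofReal', ENNReal.toReal_ofReal'] at hparts
  rw [← max_zero_sub_max_neg_zero_eq_self (v x), hparts, sub_self, Pi.zero_apply]

lemma re_ae_eq_zero_of_integral_mul_exp_eq_zero {v : E → ℂ} (hv : Integrable v μ)
    (h : ∀ L : StrongDual ℝ E, ∫ x, v x * exp (L x * I) ∂μ = 0) :
    (fun x => (v x).re) =ᵐ[μ] 0 := by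
  have hconj : Integrable (fun x => conj (v x)) μ :=
    (RCLike.conjCLE (K := ℂ)).toContinuousLinearMap.integrable_comp hv
  have hzero (L : StrongDual ℝ E) : ∫ x, conj (v x) * exp (L x * I) ∂μ = 0 := by
    rw [← map_zero conj, ← h (-L), ← integral_conj]
    simp [← exp_conj]
  refine ae_eq_zero_of_integral_ofReal_mul_exp_eq_zero hv.re fun L => ?_
  have hre (x : E) : ((v x).re : ℂ) * exp (L x * I) =
      1 / 2 * (v x * exp (L x * I) + conj (v x) * exp (L x * I)) := by
    rw [re_eq_add_conj]
    ring
  simp only [hre]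
  rw [integral_const_mul, integral_add (integrable_mul_exp_dual hv L)
    (integrable_mul_exp_dual hconj L), h, hzero, add_zero, mul_zero]

lemma ae_eq_zero_of_integral_mul_exp_eq_zero {v : E → ℂ} (hv : Integrable v μ)
    (h : ∀ L : StrongDual ℝ E, ∫ x, v x * exp (L x * I) ∂μ = 0) : v =ᵐ[μ] 0 := by
  have him := re_ae_eq_zero_of_integral_mul_exp_eq_zero (hv.const_mul (-I)) fun L => by
    simp only [mul_assoc, integral_const_mul, h, mul_zero]
  filter_upwards [re_ae_eq_zero_of_integral_mul_exp_eq_zero hv h, him] with x hre him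
  refine Complex.ext hre ?_
  simpa using him

end FourierUniqueness

lemma eq_zero_of_inner_modeLp_eq_zero {d : ℕ} {a : Fin d → ℝ} (ha : ∀ i, 0 < a i) {α : ℂ}
    (hα : ∀ i, 2 * ‖α * a i‖ < (α * a i).re ^ 2) {u : L2Box a}
    (h : ∀ κ b, IsRoot a α κ b → inner ℂ (modeLp a (star κ) b) u = 0) : u = 0 := by
  have hu : Integrable u (boxMeasure a) := (Lp.memLp u).integrable one_le_two
  have hmode := integral_mul_mode_eq_zero ha hα hu fun κ b hκ => by
    rw [← h κ b hκ, inner_eq_integral (coeFn_modeLp a _ b) (EventuallyEq.refl _ u)]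
    simp only [conj_mode, star_star, mul_comm]
  rw [Lp.eq_zero_iff_ae_eq_zero]
  refine ae_eq_zero_of_integral_mul_exp_eq_zero hu fun L => ?_
  have hL (x : Fin d → ℝ) : L x = ∑ i, L (Pi.single i 1) * x i := by
    conv_lhs => rw [pi_eq_sum_univ' x]
    simp [mul_comm]
  simpa only [← hL] using integral_mul_exp_eq_zero hu hmode fun i => L (Pi.single i 1)

/-! ### Large roots of the characteristic function -/

/-- The reflection coefficient of a mode with frequency `I * y`: the ratio of the two exponentials
in `cos (I * y - phase b)`. It is small when `y.re` is large. -/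
def reflection (b : Bool) (y : ℂ) : ℂ := paritySign b * exp (-2 * y)

/-- The characteristic equation `charFn b (-B) z = 0` in the variable `y = -I * z`, in which the
large root is close to `B`. -/
def IsExpRoot (b : Bool) (B y : ℂ) : Prop :=
  y * (1 - reflection b y) = B * (1 + reflection b y)

lemma reflection_eq_exp (b : Bool) (y : ℂ) :
    reflection b y = exp (2 * ((I * y - phase b) * I)) := by
  have harg : 2 * ((I * y - phase b) * I) = -(2 * phase b * I) + -2 * y := by
    linear_combination 2 * y * I_sq
  have hparity : exp (-(2 * phase b * I)) = paritySign b := by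
    cases b
    · simp [phase, paritySign]
    · rw [phase, if_pos rfl, paritySign, if_pos rfl, ofReal_div, ofReal_ofNat,
        mul_div_cancel₀ _ two_ne_zero, exp_neg, exp_pi_mul_I, inv_neg, inv_one]
  rw [harg, exp_add, hparity, reflection]

lemma charFn_I_mul_eq_zero_iff (b : Bool) (B y : ℂ) :
    charFn b (-B) (I * y) = 0 ↔ IsExpRoot b B y := by
  set w := I * y - phase b with hw
  have hexp : exp (w * I) = reflection b y * exp (-w * I) := by
    rw [reflection_eq_exp, ← hw, ← exp_add]
    congr 1
    ring
  have hfactor : charFn b (-B) (I * y) =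
      -(exp (-w * I) / 2) * (y * (1 - reflection b y) - B * (1 + reflection b y)) := by
    rw [charFn, ← hw, sin, cos, hexp]
    linear_combination y * (1 - reflection b y) * exp (-w * I) / 2 * I_sq
  rw [hfactor, mul_eq_zero_iff_left (neg_ne_zero.2 (div_ne_zero (exp_ne_zero _) two_ne_zero)),
    sub_eq_zero, IsExpRoot]

lemma hasDerivAt_reflection (b : Bool) (y : ℂ) :
    HasDerivAt (reflection b) (-2 * reflection b y) y :=
  ((((hasDerivAt_id' y).const_mul (-2)).cexp).const_mul (paritySign b)).congr_deriv (by
    rw [reflection]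
    ring)

lemma analyticAt_reflection (b : Bool) (y : ℂ) : AnalyticAt ℂ (reflection b) y := by
  unfold reflection
  fun_prop

lemma norm_reflection_le {ρ : ℝ} (b : Bool) {y : ℂ} (hy : ρ / 2 ≤ y.re) :
    ‖reflection b y‖ ≤ Real.exp (-ρ) := by
  have hre : (-2 * y).re = -2 * y.re := by simp
  rw [reflection, norm_mul, norm_paritySign, one_mul, norm_exp, hre]
  exact Real.exp_le_exp.2 (by linarith)

lemma norm_reflection_sub_le {ρ : ℝ} (b : Bool) {y₁ y₂ : ℂ} (h₁ : ρ / 2 ≤ y₁.re)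
    (h₂ : ρ / 2 ≤ y₂.re) :
    ‖reflection b y₁ - reflection b y₂‖ ≤ 2 * Real.exp (-ρ) * ‖y₁ - y₂‖ := by
  refine Convex.norm_image_sub_le_of_norm_deriv_le
    (fun y _ => (hasDerivAt_reflection b y).differentiableAt) (fun y hy => ?_)
    (convex_halfSpace_re_ge (ρ / 2)) h₂ h₁
  rw [(hasDerivAt_reflection b y).deriv, norm_mul, norm_neg, norm_ofNat]
  gcongr
  exact norm_reflection_le b hy

lemma half_le_norm_one_sub {r : ℂ} (hr : ‖r‖ ≤ 1 / 2) : 1 / 2 ≤ ‖1 - r‖ := by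
  have h := norm_sub_norm_le 1 r
  rw [norm_one] at h
  linarith

lemma one_sub_ne_zero {r : ℂ} (hr : ‖r‖ ≤ 1 / 2) : 1 - r ≠ 0 :=
  norm_pos_iff.1 (one_half_pos.trans_le (half_le_norm_one_sub hr))

lemma one_add_ne_zero {r : ℂ} (hr : ‖r‖ ≤ 1 / 2) : 1 + r ≠ 0 := by
  simpa using one_sub_ne_zero (r := -r) (by rwa [norm_neg])

/-- The map `y ↦ B (1 + r) / (1 - r)` with `r = reflection b y`, whose fixed points are the
solutions of the characteristic equation. -/
def expRootMap (b : Bool) (B y : ℂ) : ℂ :=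
  B * ((1 + reflection b y) / (1 - reflection b y))

lemma isExpRoot_iff_isFixedPt {b : Bool} {B y : ℂ} (hy : ‖reflection b y‖ ≤ 1 / 2) :
    IsExpRoot b B y ↔ Function.IsFixedPt (expRootMap b B) y := by
  rw [IsExpRoot, Function.IsFixedPt, expRootMap, ← mul_div_assoc,
    div_eq_iff (one_sub_ne_zero hy), eq_comm]

lemma norm_expRootMap_sub_le {b : Bool} {ρ : ℝ} (B : ℂ) (hρ : Real.exp (-ρ) ≤ 1 / 2)
    {y₁ y₂ : ℂ} (h₁ : ρ / 2 ≤ y₁.re) (h₂ : ρ / 2 ≤ y₂.re) :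
    ‖expRootMap b B y₁ - expRootMap b B y₂‖ ≤ 16 * ‖B‖ * Real.exp (-ρ) * ‖y₁ - y₂‖ := by
  have hr₁ := (norm_reflection_le b h₁).trans hρ
  have hr₂ := (norm_reflection_le b h₂).trans hρ
  have hne₁ := one_sub_ne_zero hr₁
  have hne₂ := one_sub_ne_zero hr₂
  have hdiff := norm_reflection_sub_le b h₁ h₂
  unfold expRootMap
  set r₁ := reflection b y₁
  set r₂ := reflection b y₂
  have heq : B * ((1 + r₁) / (1 - r₁)) - B * ((1 + r₂) / (1 - r₂)) =
      B * (2 * (r₁ - r₂)) / ((1 - r₁) * (1 - r₂)) := by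
    field_simp
    ring
  have hden : 1 / 2 * (1 / 2) ≤ ‖1 - r₁‖ * ‖1 - r₂‖ := by
    gcongr <;> exact half_le_norm_one_sub ‹_›
  rw [heq, norm_div, norm_mul, norm_mul, norm_mul, norm_ofNat, div_le_iff₀ (by linarith)]
  calc ‖B‖ * (2 * ‖r₁ - r₂‖) ≤ ‖B‖ * (2 * (2 * Real.exp (-ρ) * ‖y₁ - y₂‖)) := by gcongr
    _ = 16 * ‖B‖ * Real.exp (-ρ) * ‖y₁ - y₂‖ * (1 / 2 * (1 / 2)) := by ring
    _ ≤ _ := by gcongr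

lemma norm_expRootMap_sub_self_le {b : Bool} {ρ : ℝ} (B : ℂ) (hρ : Real.exp (-ρ) ≤ 1 / 2)
    {y : ℂ} (h : ρ / 2 ≤ y.re) : ‖expRootMap b B y - B‖ ≤ 4 * ‖B‖ * Real.exp (-ρ) := by
  have hr := norm_reflection_le b h
  have hne := one_sub_ne_zero (hr.trans hρ)
  have hden := half_le_norm_one_sub (hr.trans hρ)
  unfold expRootMap
  set r := reflection b y
  have heq : B * ((1 + r) / (1 - r)) - B = B * (2 * r) / (1 - r) := by
    field_simp
    ring
  rw [heq, norm_div, norm_mul, norm_mul, norm_ofNat, div_le_iff₀ (by linarith)]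
  calc ‖B‖ * (2 * ‖r‖) ≤ ‖B‖ * (2 * Real.exp (-ρ)) := by gcongr
    _ = 4 * ‖B‖ * Real.exp (-ρ) * (1 / 2) := by ring
    _ ≤ _ := by gcongr

lemma IsExpRoot.unique {b : Bool} {B : ℂ} {ρ : ℝ} (hρ : Real.exp (-ρ) ≤ 1 / 2)
    (hB : 16 * ‖B‖ * Real.exp (-ρ) < 1) {y₁ y₂ : ℂ} (h₁ : ρ / 2 ≤ y₁.re) (h₂ : ρ / 2 ≤ y₂.re)
    (hy₁ : IsExpRoot b B y₁) (hy₂ : IsExpRoot b B y₂) : y₁ = y₂ := by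
  have hcontr := norm_expRootMap_sub_le (b := b) B hρ h₁ h₂
  rw [(isExpRoot_iff_isFixedPt ((norm_reflection_le b h₁).trans hρ)).1 hy₁,
    (isExpRoot_iff_isFixedPt ((norm_reflection_le b h₂).trans hρ)).1 hy₂] at hcontr
  by_contra hne
  have hpos : 0 < ‖y₁ - y₂‖ := norm_pos_iff.2 (sub_ne_zero.2 hne)
  exact (mul_lt_of_lt_one_left hpos hB).not_ge hcontr

/-- `B` is so large that `expRootMap b B` contracts the half-plane `B.re / 2 ≤ y.re`. -/
def IsLarge (B : ℂ) : Prop := 1 < B.re ∧ 32 * ‖B‖ * Real.exp (-B.re) < 1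

lemma isOpen_setOf_isLarge : IsOpen {B : ℂ | IsLarge B} :=
  (isOpen_lt continuous_const continuous_re).inter
    (isOpen_lt (f := fun B : ℂ => 32 * ‖B‖ * Real.exp (-B.re)) (by fun_prop) continuous_const)

lemma IsLarge.exp_le {B : ℂ} (h : IsLarge B) : Real.exp (-B.re) ≤ 1 / 32 := by
  have hB : 1 ≤ ‖B‖ := h.1.le.trans (re_le_norm B)
  nlinarith [h.2, Real.exp_pos (-B.re)]

lemma IsLarge.exp_le_half {B : ℂ} (h : IsLarge B) : Real.exp (-B.re) ≤ 1 / 2 :=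
  h.exp_le.trans (by norm_num)

lemma exists_isExpRoot (b : Bool) {B : ℂ} (h : IsLarge B) :
    ∃ y : ℂ, B.re / 2 ≤ y.re ∧ IsExpRoot b B y := by
  have hmaps : Set.MapsTo (expRootMap b B) {y | B.re / 2 ≤ y.re} {y | B.re / 2 ≤ y.re} := by
    intro y hy
    have hnorm := norm_expRootMap_sub_self_le (b := b) B h.exp_le_half hy
    have hre := (abs_le.1 ((abs_re_le_norm _).trans hnorm)).1
    rw [sub_re] at hre
    change B.re / 2 ≤ _
    linarith [h.1, h.2]
  have hcontr : ContractingWith (1 / 2) (hmaps.restrict (expRootMap b B) _ _) := by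
    refine ⟨by rw [← NNReal.coe_lt_coe]; norm_num, LipschitzWith.of_dist_le_mul fun y₁ y₂ => ?_⟩
    rw [Subtype.dist_eq, Subtype.dist_eq, dist_eq_norm, dist_eq_norm]
    refine (norm_expRootMap_sub_le B h.exp_le_half y₁.2 y₂.2).trans ?_
    gcongr
    push_cast
    linarith [h.2]
  obtain ⟨y, hy, hfix, -⟩ := hcontr.exists_fixedPoint'
    (isClosed_le continuous_const continuous_re).isComplete hmaps (x := B)
    (by change B.re / 2 ≤ B.re; linarith [h.1]) (edist_ne_top _ _)
  exact ⟨y, hy,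
    (isExpRoot_iff_isFixedPt ((norm_reflection_le b hy).trans h.exp_le_half)).2 hfix⟩

open Classical in
/-- The solution of the characteristic equation in the half-plane `B.re / 2 ≤ y.re`, with junk
value `0` if `B` is not large. -/
def largeRoot (b : Bool) (B : ℂ) : ℂ :=
  if h : IsLarge B then (exists_isExpRoot b h).choose else 0

lemma le_re_largeRoot (b : Bool) {B : ℂ} (h : IsLarge B) : B.re / 2 ≤ (largeRoot b B).re := by
  rw [largeRoot, dif_pos h]
  exact (exists_isExpRoot b h).choose_spec.1

lemma isExpRoot_largeRoot (b : Bool) {B : ℂ} (h : IsLarge B) : IsExpRoot b B (largeRoot b B) := by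
  rw [largeRoot, dif_pos h]
  exact (exists_isExpRoot b h).choose_spec.2

lemma norm_reflection_largeRoot_le (b : Bool) {B : ℂ} (h : IsLarge B) :
    ‖reflection b (largeRoot b B)‖ ≤ Real.exp (-B.re) :=
  norm_reflection_le b (le_re_largeRoot b h)

lemma norm_largeRoot_sub_le (b : Bool) {B : ℂ} (h : IsLarge B) : ‖largeRoot b B - B‖ ≤ 1 / 4 := by
  have hnorm := norm_expRootMap_sub_self_le (b := b) B h.exp_le_half (le_re_largeRoot b h)
  rw [(isExpRoot_iff_isFixedPt ((norm_reflection_largeRoot_le b h).trans h.exp_le_half)).1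
    (isExpRoot_largeRoot b h)] at hnorm
  linarith [h.2]

lemma IsExpRoot.eq_largeRoot {b : Bool} {B y : ℂ} (h : IsLarge B) (hy : B.re / 2 ≤ y.re)
    (hroot : IsExpRoot b B y) : y = largeRoot b B := by
  refine hroot.unique h.exp_le_half ?_ hy (le_re_largeRoot b h) (isExpRoot_largeRoot b h)
  nlinarith [h.2, norm_nonneg B, Real.exp_pos (-B.re)]

lemma lt_re_largeRoot (b : Bool) {B : ℂ} (h : IsLarge B) : B.re / 2 < (largeRoot b B).re := by
  have hre := (abs_le.1 ((abs_re_le_norm _).trans (norm_largeRoot_sub_le b h))).1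
  rw [sub_re] at hre
  linarith [h.1]

lemma exists_analyticAt_rightInverse {f : ℂ → ℂ} {x f' : ℂ} (hf : AnalyticAt ℂ f x)
    (hderiv : HasDerivAt f f' x) (hf' : f' ≠ 0) :
    ∃ g : ℂ → ℂ, AnalyticAt ℂ g (f x) ∧ g (f x) = x ∧ ∀ᶠ w in 𝓝 (f x), f (g w) = w := by
  have hne : deriv f x ≠ 0 := by rwa [hderiv.deriv]
  exact ⟨_, hf.analyticAt_localInverse hne, HasStrictFDerivAt.localInverse_apply_image ..,
    HasStrictDerivAt.eventually_right_inverse ..⟩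

/-- The parameter `B` for which `y` solves the characteristic equation. -/
def parameterOfRoot (b : Bool) (y : ℂ) : ℂ := y * (1 - reflection b y) / (1 + reflection b y)

lemma isExpRoot_iff_parameterOfRoot_eq {b : Bool} {B y : ℂ} (hy : ‖reflection b y‖ ≤ 1 / 2) :
    IsExpRoot b B y ↔ parameterOfRoot b y = B := by
  rw [IsExpRoot, parameterOfRoot, div_eq_iff (one_add_ne_zero hy)]

lemma hasDerivAt_parameterOfRoot {b : Bool} {y : ℂ} (hy : 1 + reflection b y ≠ 0) :
    HasDerivAt (parameterOfRoot b) ((1 - reflection b y +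
      2 * reflection b y * (y + parameterOfRoot b y)) / (1 + reflection b y)) y := by
  have hr := hasDerivAt_reflection b y
  refine (((hasDerivAt_id' y).mul (hr.const_sub 1)).div (hr.const_add 1) hy).congr_deriv ?_
  rw [parameterOfRoot, Pi.mul_apply]
  field_simp
  ring

lemma deriv_parameterOfRoot_numerator_ne_zero {b : Bool} {B : ℂ} (h : IsLarge B) :
    1 - reflection b (largeRoot b B) +
      2 * reflection b (largeRoot b B) * (largeRoot b B + B) ≠ 0 := by
  set r := reflection b (largeRoot b B)
  have hr : ‖r‖ ≤ Real.exp (-B.re) := norm_reflection_largeRoot_le b h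
  have hB : 1 ≤ ‖B‖ := h.1.le.trans (re_le_norm B)
  have hsum : ‖largeRoot b B + B‖ ≤ 3 * ‖B‖ := calc
    ‖largeRoot b B + B‖ = ‖(largeRoot b B - B) + 2 * B‖ := by ring_nf
    _ ≤ 1 / 4 + 2 * ‖B‖ := by
      refine (norm_add_le _ _).trans (add_le_add (norm_largeRoot_sub_le b h) ?_)
      rw [norm_mul, norm_ofNat]
    _ ≤ 3 * ‖B‖ := by linarith
  have hsmall : ‖-(2 * r * (largeRoot b B + B))‖ ≤ 6 / 32 := by
    rw [norm_neg, norm_mul, norm_mul, norm_ofNat]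
    calc 2 * ‖r‖ * ‖largeRoot b B + B‖ ≤ 2 * Real.exp (-B.re) * (3 * ‖B‖) := by gcongr
      _ ≤ 6 / 32 := by linarith [h.2]
  have hhalf := half_le_norm_one_sub (hr.trans h.exp_le_half)
  have htri := norm_sub_norm_le (1 - r) (-(2 * r * (largeRoot b B + B)))
  rw [sub_neg_eq_add] at htri
  exact norm_pos_iff.1 (by linarith)

lemma analyticAt_largeRoot (b : Bool) {B : ℂ} (h : IsLarge B) : AnalyticAt ℂ (largeRoot b) B := by
  have hr := (norm_reflection_largeRoot_le b h).trans h.exp_le_half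
  have hne := one_add_ne_zero hr
  have hparam := (isExpRoot_iff_parameterOfRoot_eq hr).1 (isExpRoot_largeRoot b h)
  have hanalytic : AnalyticAt ℂ (parameterOfRoot b) (largeRoot b B) :=
    ((analyticAt_id).mul (analyticAt_const.sub (analyticAt_reflection b _))).div
      (analyticAt_const.add (analyticAt_reflection b _)) hne
  have hderiv := hasDerivAt_parameterOfRoot hne
  rw [hparam] at hderiv
  obtain ⟨g, hg, hgB, hright⟩ := exists_analyticAt_rightInverse hanalytic hderiv
    (div_ne_zero (deriv_parameterOfRoot_numerator_ne_zero h) hne)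
  rw [hparam] at hg hgB hright
  have hre : ∀ᶠ w in 𝓝 B, w.re / 2 < (g w).re := by
    refine ContinuousAt.eventually_lt (by fun_prop)
      (continuous_re.continuousAt.comp hg.continuousAt) ?_
    simpa only [hgB] using lt_re_largeRoot b h
  refine hg.congr ?_
  filter_upwards [hright, hre, isOpen_setOf_isLarge.mem_nhds h] with w hw hwre hwlarge
  exact IsExpRoot.eq_largeRoot hwlarge hwre.le ((isExpRoot_iff_parameterOfRoot_eq
    ((norm_reflection_le b hwre.le).trans hwlarge.exp_le_half)).2 hw)

/-! ### Roots in the sector -/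

-- Dividing `charFn b A z = 0` by `A * z * sin (z - phase b)` gives `cos / (z sin) = 1 / A`, whose
-- left-hand side has a simple zero at `r`.
lemma exists_analyticAt_zero_charFn {b : Bool} {r : ℂ} (hr : r ≠ 0)
    (hcos : cos (r - phase b) = 0) :
    ∃ g : ℂ → ℂ, AnalyticAt ℂ g 0 ∧ g 0 = r ∧
      ∀ᶠ w in 𝓝 (0 : ℂ), ∀ A, A * w = 1 → charFn b A (g w) = 0 := by
  have hsin : sin (r - phase b) ≠ 0 := fun h => by
    simpa [h, hcos] using sin_sq_add_cos_sq (r - phase b)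
  have hne : r * sin (r - phase b) ≠ 0 := mul_ne_zero hr hsin
  have hanalytic : AnalyticAt ℂ (fun z : ℂ => cos (z - phase b) / (z * sin (z - phase b))) r :=
    AnalyticAt.div (by fun_prop) (by fun_prop) hne
  have hderiv : HasDerivAt (fun z : ℂ => cos (z - phase b) / (z * sin (z - phase b)))
      (-(1 / r)) r := by
    have hsub : HasDerivAt (fun z : ℂ => z - phase b) 1 r := (hasDerivAt_id' r).sub_const _
    refine (hsub.ccos.div ((hasDerivAt_id' r).mul hsub.csin) hne).congr_deriv ?_
    simp only [Pi.mul_apply, hcos]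
    field_simp
    ring
  obtain ⟨g, hg, hg0, hright⟩ := exists_analyticAt_rightInverse hanalytic hderiv
    (neg_ne_zero.2 (one_div_ne_zero hr))
  simp only [hcos, zero_div] at hg hg0 hright
  have hden : ContinuousAt (fun w => g w * sin (g w - phase b)) 0 :=
    hg.continuousAt.mul
      (continuous_sin.continuousAt.comp (hg.continuousAt.sub continuousAt_const))
  refine ⟨g, hg, hg0, ?_⟩
  filter_upwards [hright, hden.eventually_ne (by rwa [hg0])] with w hw hw0 A hA
  rw [div_eq_iff hw0] at hw
  rw [charFn]
  linear_combination -A * hw - g w * sin (g w - phase b) * hA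

lemma tendsto_norm_sectorAtInfty (φ : ℝ) : Tendsto norm (sectorAtInfty φ) atTop :=
  tendsto_norm_cobounded_atTop.mono_left inf_le_left

lemma eventually_cos_mul_norm_le {φ : ℝ} (hφ : φ < π / 2) :
    ∀ᶠ α in sectorAtInfty φ, Real.cos φ * ‖α‖ ≤ (-α).re := by
  have hmem : ∀ᶠ α in sectorAtInfty φ, α ∈ sectorNeg φ := mem_inf_of_right (mem_principal_self _)
  filter_upwards [hmem] with α hα
  rw [← norm_mul_cos_arg (-α), norm_neg, mul_comm, ← Real.cos_abs (arg (-α))]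
  gcongr
  exact Real.cos_le_cos_of_nonneg_of_le_pi (abs_nonneg _) (by linarith [Real.pi_pos]) hα.2.le

lemma eventually_mul_norm_mul_exp_lt_one {c : ℝ} (φ : ℝ) (hc : 0 < c) (K : ℝ) :
    ∀ᶠ α in sectorAtInfty φ, K * ‖α‖ * Real.exp (-(c * ‖α‖)) < 1 := by
  have hlim := ((tendsto_rpow_mul_exp_neg_mul_atTop_nhds_zero 1 c hc).const_mul K).comp
    (tendsto_norm_sectorAtInfty φ)
  rw [mul_zero] at hlim
  filter_upwards [hlim.eventually (gt_mem_nhds one_pos)] with α hα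
  simpa only [Function.comp, Real.rpow_one, neg_mul, mul_assoc] using hα

lemma exists_isExpRoot_of_charFn_eq_zero {b : Bool} {α κ : ℂ} {l : ℝ}
    (hκ : charFn b (α * l) (κ * l) = 0) :
    ∃ k : ℂ, (κ = I * k ∨ κ = -(I * k)) ∧ 0 ≤ k.re ∧ IsExpRoot b (-(α * l)) (k * l) := by
  have hroot {k : ℂ} (hk : charFn b (α * l) (I * (k * l)) = 0) : IsExpRoot b (-(α * l)) (k * l) :=
    (charFn_I_mul_eq_zero_iff b _ _).1 (by rwa [neg_neg])
  rcases le_total 0 (-(I * κ)).re with hre | hre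
  · refine ⟨-(I * κ), Or.inl ?_, hre, hroot ?_⟩
    · linear_combination κ * I_sq
    · rw [← hκ]
      congr 1
      linear_combination (-κ * l) * I_sq
  · refine ⟨I * κ, Or.inr ?_, by simpa using hre, hroot ?_⟩
    · linear_combination κ * I_sq
    · have hneg : I * (I * κ * l) = -(κ * l) := by linear_combination κ * l * I_sq
      rw [hneg, charFn_neg, hκ, mul_zero]

lemma cos_pos_of_angle {φ : ℝ} (hφ₀ : 0 < φ) (hφ : φ < π / 2) : 0 < Real.cos φ :=
  Real.cos_pos_of_mem_Ioo ⟨by linarith, hφ⟩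

lemma norm_mul_ofReal_of_pos {l : ℝ} (hl : 0 < l) (α : ℂ) : ‖α * l‖ = l * ‖α‖ := by
  rw [norm_mul, norm_real, Real.norm_of_nonneg hl.le, mul_comm]

lemma re_neg_mul_ofReal (l : ℝ) (α : ℂ) : (-(α * l)).re = l * (-α).re := by
  simp [mul_comm]

section Sector

variable {φ l : ℝ} (hφ₀ : 0 < φ) (hφ : φ < π / 2) (hl : 0 < l)

include hφ₀ hφ hl

lemma eventually_isLarge : ∀ᶠ α in sectorAtInfty φ, IsLarge (-(α * l)) := by
  have hc : 0 < l * Real.cos φ := mul_pos hl (cos_pos_of_angle hφ₀ hφ)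
  filter_upwards [eventually_cos_mul_norm_le hφ, eventually_mul_norm_mul_exp_lt_one φ hc (32 * l),
    (tendsto_norm_sectorAtInfty φ).eventually_gt_atTop (1 / (l * Real.cos φ))]
    with α hcos hexp hnorm
  have hre : l * Real.cos φ * ‖α‖ ≤ l * (-α).re := by
    rw [mul_assoc]
    gcongr
  rw [div_lt_iff₀' hc] at hnorm
  rw [IsLarge, norm_neg, norm_mul_ofReal_of_pos hl, re_neg_mul_ofReal, ← mul_assoc 32]
  refine ⟨hnorm.trans_le hre, lt_of_le_of_lt ?_ hexp⟩
  gcongr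

lemma eventually_two_mul_norm_lt :
    ∀ᶠ α in sectorAtInfty φ, 2 * ‖α * (l : ℂ)‖ < (α * (l : ℂ)).re ^ 2 := by
  have hc := cos_pos_of_angle hφ₀ hφ
  filter_upwards [eventually_cos_mul_norm_le hφ,
    (tendsto_norm_sectorAtInfty φ).eventually_gt_atTop (2 / (l * Real.cos φ ^ 2)),
    (tendsto_norm_sectorAtInfty φ).eventually_gt_atTop 0] with α hcos hnorm hpos
  rw [div_lt_iff₀' (by positivity)] at hnorm
  have hsq : (Real.cos φ * ‖α‖) ^ 2 ≤ α.re ^ 2 := by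
    rw [← neg_sq α.re, ← neg_re]
    gcongr
  rw [norm_mul_ofReal_of_pos hl, re_mul_ofReal, mul_pow]
  calc 2 * (l * ‖α‖) < l * Real.cos φ ^ 2 * ‖α‖ * (l * ‖α‖) := by gcongr
    _ = (Real.cos φ * ‖α‖) ^ 2 * l ^ 2 := by ring
    _ ≤ α.re ^ 2 * l ^ 2 := by gcongr

lemma eventually_eq_largeRoot {δ : ℝ} (hδ : 0 < δ) (hδφ : δ ≤ Real.cos φ / 2) :
    ∀ᶠ α in sectorAtInfty φ, ∀ b y, IsExpRoot b (-(α * l)) y → δ * l * ‖α‖ ≤ y.re →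
      y = largeRoot b (-(α * l)) := by
  filter_upwards [eventually_isLarge hφ₀ hφ hl, eventually_cos_mul_norm_le hφ,
    eventually_mul_norm_mul_exp_lt_one φ (c := 2 * (δ * l)) (by positivity) (16 * l),
    (tendsto_norm_sectorAtInfty φ).eventually_ge_atTop (1 / l)]
    with α hlarge hcos hexp hnorm b y hy hre
  rw [div_le_iff₀' hl] at hnorm
  have hre' : δ * l * ‖α‖ ≤ (largeRoot b (-(α * l))).re := calc
    δ * l * ‖α‖ = l * (δ * ‖α‖) := by ring
    _ ≤ l * (Real.cos φ / 2 * ‖α‖) := by gcongr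
    _ ≤ l * ((-α).re / 2) := by
      gcongr
      linarith
    _ = (-(α * l)).re / 2 := by rw [re_neg_mul_ofReal, mul_div_assoc]
    _ ≤ _ := le_re_largeRoot b hlarge
  refine hy.unique (ρ := 2 * (δ * l) * ‖α‖) ?_ ?_ (by linarith) (by linarith)
    (isExpRoot_largeRoot b hlarge)
  · nlinarith [Real.exp_pos (-(2 * (δ * l) * ‖α‖))]
  · rwa [norm_neg, norm_mul_ofReal_of_pos hl, ← mul_assoc]

lemma eventually_root_dichotomy {δ : ℝ} (hδ : 0 < δ) (hδφ : δ ≤ Real.cos φ / 2) :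
    ∀ᶠ α in sectorAtInfty φ, ∀ b κ, charFn b (α * l) (κ * l) = 0 →
      ∃ k : ℂ, (κ = I * k ∨ κ = -(I * k)) ∧ 0 ≤ k.re ∧
        (k = largeRoot b (-(α * l)) / l ∨ k.re ≤ δ * ‖α‖) := by
  filter_upwards [eventually_eq_largeRoot hφ₀ hφ hl hδ hδφ] with α huniq b κ hκ
  obtain ⟨k, hk, hre, hroot⟩ := exists_isExpRoot_of_charFn_eq_zero hκ
  refine ⟨k, hk, hre, or_iff_not_imp_right.2 fun hlt => ?_⟩
  rw [eq_div_iff (ofReal_ne_zero.2 hl.ne')]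
  refine huniq b _ hroot ?_
  rw [re_mul_ofReal, mul_right_comm]
  exact mul_le_mul_of_nonneg_right (not_le.1 hlt).le hl.le

end Sector

/-! ### Sums of squares of frequencies -/

lemma norm_sq_sub_sq_le {k β : ℂ} {δ : ℝ} (hδ : δ ≤ 1) (h : ‖k - β‖ ≤ δ * ‖β‖) :
    ‖k ^ 2 - β ^ 2‖ ≤ 3 * δ * ‖β‖ ^ 2 := by
  have hsum : ‖(k - β) + 2 * β‖ ≤ 3 * ‖β‖ := calc
    ‖(k - β) + 2 * β‖ ≤ δ * ‖β‖ + 2 * ‖β‖ := by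
      refine (norm_add_le _ _).trans (add_le_add h ?_)
      rw [norm_mul, norm_ofNat]
    _ ≤ 1 * ‖β‖ + 2 * ‖β‖ := by gcongr
    _ = 3 * ‖β‖ := by ring
  calc ‖k ^ 2 - β ^ 2‖ = ‖k - β‖ * ‖(k - β) + 2 * β‖ := by
        rw [← norm_mul]
        congr 1
        ring
    _ ≤ δ * ‖β‖ * (3 * ‖β‖) := mul_le_mul h hsum (norm_nonneg _) ((norm_nonneg _).trans h)
    _ = 3 * δ * ‖β‖ ^ 2 := by ring

lemma re_mul_conj_le (w β : ℂ) : |(w * conj β).re| ≤ ‖w‖ * ‖β‖ := by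
  simpa using abs_re_le_norm (w * conj β)

lemma re_sq_mul_conj_mul_re_le (k β : ℂ) :
    (k ^ 2 * conj β).re * β.re ≤ k.re ^ 2 * ‖β‖ ^ 2 := by
  rw [← normSq_eq_norm_sq, normSq_apply]
  simp only [pow_two, mul_re, mul_im, conj_re, conj_im]
  linarith [sq_nonneg (k.im * β.re - k.re * β.im)]

lemma re_sq_mul_conj_self (β : ℂ) : (β ^ 2 * conj β).re = ‖β‖ ^ 2 * β.re := by
  rw [pow_two, mul_assoc, mul_conj, re_mul_ofReal, normSq_eq_norm_sq, mul_comm]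

section SumOfSquares

variable {β : ℂ} {c δ : ℝ}

lemma re_sq_sub_sq_mul_conj_le_of_norm_le {k : ℂ} (hδ : δ ≤ 1) (hk : ‖k - β‖ ≤ δ * ‖β‖) :
    ((k ^ 2 - β ^ 2) * conj β).re ≤ 3 * δ * ‖β‖ ^ 3 := calc
  ((k ^ 2 - β ^ 2) * conj β).re ≤ ‖k ^ 2 - β ^ 2‖ * ‖β‖ := (abs_le.1 (re_mul_conj_le _ _)).2
  _ ≤ 3 * δ * ‖β‖ ^ 2 * ‖β‖ := by
    gcongr
    exact norm_sq_sub_sq_le hδ hk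
  _ = 3 * δ * ‖β‖ ^ 3 := by ring

lemma re_sq_sub_sq_mul_conj_le_of_re_le {k : ℂ} (hc : 0 < c) (hβ : β ≠ 0)
    (hβc : c * ‖β‖ ≤ β.re) (hk0 : 0 ≤ k.re) (hk : k.re ≤ c / 4 * ‖β‖) :
    ((k ^ 2 - β ^ 2) * conj β).re ≤ -(c / 2) * ‖β‖ ^ 3 := by
  have hβ0 : 0 < ‖β‖ := norm_pos_iff.2 hβ
  have hre : 0 < β.re := (mul_pos hc hβ0).trans_le hβc
  have hsmall : (k ^ 2 * conj β).re ≤ c / 16 * ‖β‖ ^ 3 := by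
    refine le_of_mul_le_mul_right ?_ hre
    calc (k ^ 2 * conj β).re * β.re ≤ k.re ^ 2 * ‖β‖ ^ 2 := re_sq_mul_conj_mul_re_le k β
      _ ≤ (c / 4 * ‖β‖) ^ 2 * ‖β‖ ^ 2 := by gcongr
      _ = c / 16 * ‖β‖ ^ 3 * (c * ‖β‖) := by ring
      _ ≤ c / 16 * ‖β‖ ^ 3 * β.re := by gcongr
  have hlarge : c * ‖β‖ ^ 3 ≤ (β ^ 2 * conj β).re := calc
    c * ‖β‖ ^ 3 = ‖β‖ ^ 2 * (c * ‖β‖) := by ring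
    _ ≤ ‖β‖ ^ 2 * β.re := by gcongr
    _ = (β ^ 2 * conj β).re := (re_sq_mul_conj_self β).symm
  have hpos : 0 < c * ‖β‖ ^ 3 := by positivity
  rw [sub_mul, sub_re]
  linarith

-- Take real parts of the product with `conj β`: a frequency with small real part lowers the sum by
-- `c ‖β‖ ^ 3 / 2`, which the other terms cannot make up for.
lemma lt_re_of_norm_sum_sq_sub_le {ι : Type*} [Fintype ι] (hc : 0 < c) (hc1 : c ≤ 1) (hδ0 : 0 < δ)
    (hδ : δ * (1 + 3 * Fintype.card ι) ≤ c / 4) (hβ : β ≠ 0) (hβc : c * ‖β‖ ≤ β.re) {k : ι → ℂ}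
    (hk0 : ∀ i, 0 ≤ (k i).re) (hk : ∀ i, ‖k i - β‖ ≤ δ * ‖β‖ ∨ (k i).re ≤ δ * ‖β‖)
    (hsum : ‖∑ i, k i ^ 2 - Fintype.card ι * β ^ 2‖ ≤ δ * ‖β‖ ^ 2) (i : ι) :
    δ * ‖β‖ < (k i).re := by
  classical
  have hcube : 0 < ‖β‖ ^ 3 := pow_pos (norm_pos_iff.2 hβ) 3
  have hδc : δ ≤ c / 4 := (le_mul_of_one_le_right hδ0.le (by simp)).trans hδ
  have hsmall (j : ι) (hj : (k j).re ≤ δ * ‖β‖) :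
      ((k j ^ 2 - β ^ 2) * conj β).re ≤ -(c / 2) * ‖β‖ ^ 3 :=
    re_sq_sub_sq_mul_conj_le_of_re_le hc hβ hβc (hk0 j) (hj.trans (by gcongr))
  have hall (j : ι) : ((k j ^ 2 - β ^ 2) * conj β).re ≤ 3 * δ * ‖β‖ ^ 3 := by
    refine (hk j).elim (re_sq_sub_sq_mul_conj_le_of_norm_le (by linarith)) fun hj =>
      (hsmall j hj).trans ?_
    gcongr
    linarith
  by_contra! hi
  have hupper : ∑ j, ((k j ^ 2 - β ^ 2) * conj β).re ≤
      -(c / 2) * ‖β‖ ^ 3 + Fintype.card ι * (3 * δ * ‖β‖ ^ 3) := by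
    rw [← Finset.add_sum_erase _ _ (Finset.mem_univ i)]
    refine add_le_add (hsmall i hi) ((Finset.sum_le_card_nsmul _ _ _ fun j _ => hall j).trans ?_)
    rw [nsmul_eq_mul]
    gcongr
    exact Finset.card_erase_le
  have hlower : -(δ * ‖β‖ ^ 3) ≤ ∑ j, ((k j ^ 2 - β ^ 2) * conj β).re := by
    rw [← re_sum, ← Finset.sum_mul, Finset.sum_sub_distrib, Finset.sum_const, Finset.card_univ,
      nsmul_eq_mul]
    refine le_trans ?_ (abs_le.1 (re_mul_conj_le _ β)).1
    rw [neg_le_neg_iff, pow_succ ‖β‖, ← mul_assoc]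
    gcongr
  nlinarith [mul_le_mul_of_nonneg_right hδ hcube.le, mul_pos hc hcube]

end SumOfSquares

/-! ### Large frequencies -/

section LargeFrequencies

variable {d : ℕ} {a : Fin d → ℝ} {φ : ℝ}

/-- The frequency in the `i`-th coordinate which comes from the large root of the characteristic
equation; it is close to `-I * α`. -/
def largeFreq (a : Fin d → ℝ) (α : ℂ) (b : Fin d → Bool) (i : Fin d) : ℂ :=
  I * (largeRoot (b i) (-(α * a i)) / a i)

lemma norm_largeRoot_div_add_le {l : ℝ} (hl : 0 < l) {α : ℂ} (h : IsLarge (-(α * l))) (b : Bool) :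
    ‖largeRoot b (-(α * l)) / l + α‖ ≤ 1 / (4 * l) := by
  have hl0 : (l : ℂ) ≠ 0 := ofReal_ne_zero.2 hl.ne'
  have heq : largeRoot b (-(α * l)) / l + α = (largeRoot b (-(α * l)) - -(α * l)) / l := by
    field_simp
    ring
  rw [heq, norm_div, norm_real, Real.norm_of_nonneg hl.le, ← div_div]
  gcongr
  exact norm_largeRoot_sub_le b h

/-- The tolerance in the separation of the eigenvalues near `-d α ^ 2` from the others. -/
def tolerance (d : ℕ) (φ : ℝ) : ℝ := Real.cos φ / (4 * (1 + 3 * d))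

lemma tolerance_pos (d : ℕ) (hφ₀ : 0 < φ) (hφ : φ < π / 2) : 0 < tolerance d φ := by
  have hc := cos_pos_of_angle hφ₀ hφ
  unfold tolerance
  positivity

lemma tolerance_mul (d : ℕ) (φ : ℝ) : tolerance d φ * (1 + 3 * d) = Real.cos φ / 4 := by
  unfold tolerance
  field_simp

lemma tolerance_le (d : ℕ) (hφ₀ : 0 < φ) (hφ : φ < π / 2) : tolerance d φ ≤ Real.cos φ / 2 := by
  have hle := le_mul_of_one_le_right (tolerance_pos d hφ₀ hφ).le
    (by simp : (1 : ℝ) ≤ 1 + 3 * d)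
  linarith [tolerance_mul d φ, cos_pos_of_angle hφ₀ hφ]

lemma eventually_norm_largeRoot_div_add_le (ha : ∀ i, 0 < a i) (hφ₀ : 0 < φ) (hφ : φ < π / 2)
    {δ : ℝ} (hδ : 0 < δ) :
    ∀ᶠ α in sectorAtInfty φ, ∀ b i, ‖largeRoot b (-(α * a i)) / a i + α‖ ≤ δ * ‖α‖ := by
  filter_upwards [eventually_all.2 fun i => eventually_isLarge hφ₀ hφ (ha i),
    eventually_all.2 fun i => (tendsto_norm_sectorAtInfty φ).eventually_ge_atTop
      (1 / (4 * a i) / δ)] with α hlarge hnorm b i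
  refine (norm_largeRoot_div_add_le (ha i) (hlarge i) b).trans ?_
  rw [← div_le_iff₀' hδ]
  exact hnorm i

lemma eventually_eq_largeFreq (ha : ∀ i, 0 < a i) (hφ₀ : 0 < φ) (hφ : φ < π / 2) :
    ∀ᶠ α in sectorAtInfty φ, ∀ κ b, IsRoot a α κ b →
      ‖∑ i, κ i ^ 2 + d * α ^ 2‖ ≤ tolerance d φ * ‖α‖ ^ 2 →
      ∀ i, κ i = largeFreq a α b i ∨ κ i = -largeFreq a α b i := by
  have hδ := tolerance_pos d hφ₀ hφ
  filter_upwards [eventually_all.2 fun i =>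
      eventually_root_dichotomy hφ₀ hφ (ha i) hδ (tolerance_le d hφ₀ hφ),
    eventually_norm_largeRoot_div_add_le ha hφ₀ hφ hδ, eventually_cos_mul_norm_le hφ,
    (tendsto_norm_sectorAtInfty φ).eventually_gt_atTop 0]
    with α hdich hclose hcos hpos κ b hκ hsum
  choose k hk hk0 hkd using fun i => hdich i (b i) (κ i) (hκ i)
  have hsq (i : Fin d) : κ i ^ 2 = -(k i ^ 2) := by
    rcases hk i with h | h <;> rw [h] <;> linear_combination k i ^ 2 * I_sq
  have hre (i : Fin d) : tolerance d φ * ‖α‖ < (k i).re := by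
    have hsum' : ‖∑ i, k i ^ 2 - Fintype.card (Fin d) * (-α) ^ 2‖ ≤ tolerance d φ * ‖-α‖ ^ 2 := by
      rw [norm_neg, ← norm_neg, Fintype.card_fin]
      refine le_of_eq_of_le (congrArg norm ?_) hsum
      simp only [hsq, Finset.sum_neg_distrib]
      ring
    have hlt := lt_re_of_norm_sum_sq_sub_le (cos_pos_of_angle hφ₀ hφ) (Real.cos_le_one φ) hδ
      (by rw [Fintype.card_fin, tolerance_mul]) (neg_ne_zero.2 (norm_pos_iff.1 hpos))
      (by rwa [norm_neg]) hk0 (fun i => ?_) hsum' i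
    · rwa [norm_neg] at hlt
    · rw [norm_neg, sub_neg_eq_add]
      exact (hkd i).imp_left fun h => by simpa only [h] using hclose (b i) i
  intro i
  rw [largeFreq, ← (hkd i).resolve_right (hre i).not_ge]
  exact hk i

end LargeFrequencies

/-! ### Eigencurves -/

section Eigencurves

variable {d : ℕ} {a : Fin d → ℝ} {α : ℂ} {κ : Fin d → ℂ} {b : Fin d → Bool} {φ : ℝ}

lemma modeLp_ne_zero {x : Fin d → ℝ} (hx : x ∈ box a) (h : mode κ b x ≠ 0) :
    modeLp a κ b ≠ 0 := by
  intro hzero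
  have hae : mode κ b =ᵐ[volume.restrict (box a)] fun _ => 0 :=
    (coeFn_modeLp a κ b).symm.trans (Lp.eq_zero_iff_ae_eq_zero.1 hzero)
  have hopen : IsOpen (box a) := isOpen_set_pi Set.finite_univ fun _ _ => isOpen_Ioo
  exact h (Measure.eqOn_open_of_ae_eq hae hopen (contDiff_mode κ b).continuous.continuousOn
    continuousOn_const hx)

lemma IsRoot.isRobinEigenvalue (ha : ∀ i, 0 < a i) (h : IsRoot a α κ b) {x : Fin d → ℝ}
    (hx : x ∈ box a) (hne : mode κ b x ≠ 0) : IsRobinEigenvalue a α (∑ i, κ i ^ 2) :=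
  ⟨modeLp a κ b, modeLp_ne_zero hx hne, h.modeLp_mem_robinLaplacian ha⟩

lemma exists_isRoot_of_isRobinEigenvalue (ha : ∀ i, 0 < a i)
    (hα : ∀ i, 2 * ‖α * a i‖ < (α * a i).re ^ 2) {μ : ℂ} (h : IsRobinEigenvalue a α μ) :
    ∃ κ b, IsRoot a α κ b ∧ ∑ i, κ i ^ 2 = μ := by
  obtain ⟨u, hu, hmem⟩ := h
  by_contra! hne
  exact hu (eq_zero_of_inner_modeLp_eq_zero ha hα fun κ b hκ =>
    hκ.inner_eq_zero_of_mem_iSup_kerPow ha (hne κ b hκ) (mem_iSup_kerPow hmem))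

lemma charFn_largeFreq {i : Fin d} (hi : 0 < a i) (h : IsLarge (-(α * a i))) (b : Fin d → Bool) :
    charFn (b i) (α * a i) (largeFreq a α b i * a i) = 0 := by
  have hroot := (charFn_I_mul_eq_zero_iff (b i) _ _).2 (isExpRoot_largeRoot (b i) h)
  rwa [neg_neg, ← div_mul_cancel₀ (largeRoot (b i) _) (ofReal_ne_zero.2 hi.ne'),
    ← mul_assoc] at hroot

lemma isRoot_largeFreq (ha : ∀ i, 0 < a i) (h : ∀ i, IsLarge (-(α * a i))) (b : Fin d → Bool) :
    IsRoot a α (largeFreq a α b) b :=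
  fun i => charFn_largeFreq (ha i) (h i) b

lemma analyticAt_largeFreq {i : Fin d} (h : IsLarge (-(α * a i))) (b : Fin d → Bool) :
    AnalyticAt ℂ (fun α => largeFreq a α b i) α :=
  analyticAt_const.mul (((analyticAt_largeRoot (b i) h).comp_of_eq
    (f := fun α : ℂ => -(α * a i)) (by fun_prop) rfl).div_const)

lemma largeFreq_sq_add_isLittleO (ha : ∀ i, 0 < a i) (hφ₀ : 0 < φ) (hφ : φ < π / 2)
    (b : Fin d → Bool) (i : Fin d) :
    (fun α => largeFreq a α b i ^ 2 + α ^ 2) =o[sectorAtInfty φ] fun α => α ^ 2 := by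
  rw [isLittleO_iff]
  intro c hc
  filter_upwards [eventually_norm_largeRoot_div_add_le ha hφ₀ hφ (δ := min (c / 3) 1)
    (lt_min (by positivity) one_pos)] with α hα
  have hsq := norm_sq_sub_sq_le (k := largeRoot (b i) (-(α * a i)) / a i) (β := -α)
    (min_le_right _ _) (by rw [sub_neg_eq_add, norm_neg]; exact hα (b i) i)
  calc ‖largeFreq a α b i ^ 2 + α ^ 2‖
      = ‖(largeRoot (b i) (-(α * a i)) / a i) ^ 2 - (-α) ^ 2‖ := by
        rw [largeFreq, mul_pow, I_sq, ← norm_neg]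
        congr 1
        ring
    _ ≤ 3 * min (c / 3) 1 * ‖-α‖ ^ 2 := hsq
    _ ≤ c * ‖α ^ 2‖ := by
        rw [norm_neg, norm_pow]
        gcongr
        linarith [min_le_left (c / 3) 1]

lemma isEquivalent_of_isLittleO {l : Filter ℂ} {f : ℂ → ℂ} {c : ℂ} (hc : c ≠ 0)
    (h : (fun α => f α + c * α ^ 2) =o[l] fun α => α ^ 2) : f ~[l] fun α => -c * α ^ 2 := by
  refine (h.const_mul_right (neg_ne_zero.2 hc)).congr_left fun α => ?_
  rw [Pi.sub_apply]
  ring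

/-- The eigenvalue of the mode with parities `b` all of whose frequencies are large, as a function
of the Robin parameter. -/
def largeCurve (a : Fin d → ℝ) (b : Fin d → Bool) (α : ℂ) : ℂ := ∑ i, largeFreq a α b i ^ 2

lemma isEquivalent_largeCurve (hd : d ≠ 0) (ha : ∀ i, 0 < a i) (hφ₀ : 0 < φ) (hφ : φ < π / 2)
    (b : Fin d → Bool) : largeCurve a b ~[sectorAtInfty φ] fun α => -(d : ℂ) * α ^ 2 := by
  refine isEquivalent_of_isLittleO (Nat.cast_ne_zero.2 hd) ?_
  refine (IsLittleO.sum (s := Finset.univ) fun i _ =>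
    largeFreq_sq_add_isLittleO ha hφ₀ hφ b i).congr_left fun α => ?_
  simp [largeCurve, Finset.sum_add_distrib]

lemma cos_I_mul_sub_phase_ne_zero (b : Bool) {k : ℂ} (hk : k.re ≠ 0) {t : ℝ} (ht : t ≠ 0) :
    cos (I * k * t - phase b) ≠ 0 := by
  intro h
  have him : (I * k * t - phase b).im = k.re * t := by simp
  have hnorm := norm_cos_sq (I * k * t - phase b)
  rw [h, norm_zero, zero_pow two_ne_zero, him] at hnorm
  have hsinh : Real.sinh (k.re * t) ^ 2 = 0 :=
    ((add_eq_zero_iff_of_nonneg (sq_nonneg _) (sq_nonneg _)).1 hnorm.symm).2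
  exact mul_ne_zero hk ht (Real.sinh_eq_zero.1 (sq_eq_zero_iff.1 hsinh))

lemma half_mem_box (ha : ∀ i, 0 < a i) : (fun i => a i / 2) ∈ box a :=
  fun i _ => ⟨by linarith [ha i], by linarith [ha i]⟩

lemma mode_largeFreq_ne_zero (ha : ∀ i, 0 < a i) (h : ∀ i, IsLarge (-(α * a i)))
    (b : Fin d → Bool) : mode (largeFreq a α b) b (fun i => a i / 2) ≠ 0 := by
  refine Finset.prod_ne_zero_iff.2 fun i _ =>
    cos_I_mul_sub_phase_ne_zero (b i) ?_ (div_pos (ha i) two_pos).ne'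
  rw [div_ofReal_re]
  have hre := le_re_largeRoot (b i) (h i)
  exact (div_pos (by linarith [(h i).1]) (ha i)).ne'

lemma isEigencurve_largeCurve (ha : ∀ i, 0 < a i) (hφ₀ : 0 < φ) (hφ : φ < π / 2)
    (b : Fin d → Bool) : IsEigencurve a φ (largeCurve a b) := by
  filter_upwards [eventually_all.2 fun i => eventually_isLarge hφ₀ hφ (ha i)] with α hα
  exact ⟨(isRoot_largeFreq ha hα b).isRobinEigenvalue ha (half_mem_box ha)
      (mode_largeFreq_ne_zero ha hα b),
    Finset.analyticAt_fun_sum _ fun i _ => (analyticAt_largeFreq (hα i) b).pow 2⟩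

lemma sum_sq_eq_largeCurve (h : ∀ i, κ i = largeFreq a α b i ∨ κ i = -largeFreq a α b i) :
    ∑ i, κ i ^ 2 = largeCurve a b α :=
  Finset.sum_congr rfl fun i _ => sq_eq_sq_iff_eq_or_eq_neg.2 (h i)

lemma eventually_norm_add_le {l : Filter ℂ} {f : ℂ → ℂ} {c : ℂ} (hc : c ≠ 0)
    (h : f ~[l] fun α => -c * α ^ 2) {δ : ℝ} (hδ : 0 < δ) :
    ∀ᶠ α in l, ‖f α + c * α ^ 2‖ ≤ δ * ‖α‖ ^ 2 := by
  have hlittle : (fun α => f α + c * α ^ 2) =o[l] fun α => α ^ 2 :=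
    ((isLittleO_const_mul_right_iff (neg_ne_zero.2 hc)).1 h).congr_left fun α => by
      rw [Pi.sub_apply]
      ring
  simpa only [norm_pow] using hlittle.def hδ

end Eigencurves

/-! ### Multiplicities -/

section Multiplicities

variable {d : ℕ} {a : Fin d → ℝ} {κ κ' : Fin d → ℂ} {b b' : Fin d → Bool}

lemma exists_mode_eq_const_mul (b : Fin d → Bool) (h : ∀ i, κ i = κ' i ∨ κ i = -κ' i) :
    ∃ ε : ℂ, ∀ x, mode κ b x = ε * mode κ' b x := by
  have hfactor (i : Fin d) : ∃ ε : ℂ, ∀ t : ℝ, cos (κ i * t - phase (b i)) =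
      ε * cos (κ' i * t - phase (b i)) := by
    rcases h i with h | h
    · exact ⟨1, fun t => by rw [h, one_mul]⟩
    · exact ⟨paritySign (b i), fun t => by rw [h, neg_mul, cos_neg_sub_phase]⟩
  choose ε hε using hfactor
  exact ⟨∏ i, ε i, fun x => by simp only [mode, hε, Finset.prod_mul_distrib]⟩

lemma inner_modeLp_star (κ : Fin d → ℂ) (b : Fin d → Bool) (u : L2Box a) :
    inner ℂ (modeLp a (star κ) b) u = ∫ x, mode κ b x * u x ∂(boxMeasure a) := by
  rw [inner_eq_integral (coeFn_modeLp a _ b) (EventuallyEq.refl _ (u : _ → ℂ))]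
  simp only [conj_mode, star_star]

lemma inner_modeLp_eq_zero_of_neg (h : ∀ i, κ i = κ' i ∨ κ i = -κ' i) {u : L2Box a}
    (hu : inner ℂ (modeLp a (star κ') b) u = 0) : inner ℂ (modeLp a (star κ) b) u = 0 := by
  obtain ⟨ε, hε⟩ := exists_mode_eq_const_mul b h
  rw [inner_modeLp_star] at hu ⊢
  simp only [hε, mul_assoc]
  rw [integral_const_mul, hu, mul_zero]

lemma integral_Ioo_eq_zero_of_odd {f : ℝ → ℂ} {l : ℝ} (hl : 0 ≤ l) (h : ∀ t, f (-t) = -f t) :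
    ∫ t in Set.Ioo (-l) l, f t = 0 := by
  rw [← integral_Ioc_eq_integral_Ioo, ← intervalIntegral.integral_of_le (by linarith)]
  have hneg := intervalIntegral.integral_comp_neg (a := -l) (b := l) f
  simp only [h, neg_neg, intervalIntegral.integral_neg] at hneg
  exact self_eq_neg.1 hneg.symm

lemma inner_modeLp_of_ne (ha : ∀ i, 0 ≤ a i) (h : b ≠ b') :
    inner ℂ (modeLp a κ b) (modeLp a κ' b') = 0 := by
  obtain ⟨j, hj⟩ := Function.ne_iff.1 h
  have hsign : paritySign (b j) * paritySign (b' j) = -1 := by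
    cases hb : b j <;> cases hb' : b' j <;> simp_all [paritySign]
  have hneg (k : ℂ) (t : ℝ) : k * (-t : ℝ) = -(k * t) := by rw [ofReal_neg, mul_neg]
  rw [inner_eq_integral (coeFn_modeLp a κ b) (coeFn_modeLp a κ' b')]
  simp only [conj_mode]
  simp only [mode, ← Finset.prod_mul_distrib]
  rw [boxMeasure, box, volume_pi, Measure.restrict_pi_pi,
    integral_fintype_prod_eq_prod fun i (t : ℝ) =>
      cos (star κ i * t - phase (b i)) * cos (κ' i * t - phase (b' i))]
  refine Finset.prod_eq_zero (Finset.mem_univ j) (integral_Ioo_eq_zero_of_odd (ha j) fun t => ?_)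
  rw [hneg, hneg, cos_neg_sub_phase, cos_neg_sub_phase]
  linear_combination (cos (star κ j * t - phase (b j)) * cos (κ' j * t - phase (b' j))) * hsign

variable {α μ : ℂ}

/-- The map that sends a generalised eigenfunction for `μ` to its inner products with the conjugates
of the modes with large frequencies and eigenvalue `μ`. -/
def modeCoefficients (a : Fin d → ℝ) (α μ : ℂ) :
    (⨆ n, kerPow a α μ n : Submodule ℂ (L2Box a)) →ₗ[ℂ]
      ({b : Fin d → Bool // largeCurve a b α = μ} → ℂ) :=
  LinearMap.pi fun s =>
    (innerₛₗ ℂ (modeLp a (star (largeFreq a α s.1)) s.1)).comp (Submodule.subtype _)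

lemma injective_modeCoefficients (ha : ∀ i, 0 < a i)
    (hα : ∀ i, 2 * ‖α * a i‖ < (α * a i).re ^ 2)
    (hμ : ∀ κ b, IsRoot a α κ b → ∑ i, κ i ^ 2 = μ →
      ∀ i, κ i = largeFreq a α b i ∨ κ i = -largeFreq a α b i) :
    Function.Injective (modeCoefficients a α μ) := by
  refine (injective_iff_map_eq_zero _).2 fun u hu => Subtype.ext ?_
  refine eq_zero_of_inner_modeLp_eq_zero ha hα fun κ b hκ => ?_
  by_cases hsum : ∑ i, κ i ^ 2 = μ
  · have hκb := hμ κ b hκ hsum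
    exact inner_modeLp_eq_zero_of_neg hκb
      (congrFun hu ⟨b, (sum_sq_eq_largeCurve hκb).symm.trans hsum⟩)
  · exact hκ.inner_eq_zero_of_mem_iSup_kerPow ha hsum u.2

lemma modeLp_largeFreq_mem_iSup_kerPow (ha : ∀ i, 0 < a i) (hα : ∀ i, IsLarge (-(α * a i)))
    (b : Fin d → Bool) : modeLp a (largeFreq a α b) b ∈ ⨆ n, kerPow a α (largeCurve a b α) n :=
  mem_iSup_kerPow ((isRoot_largeFreq ha hα b).modeLp_mem_robinLaplacian ha)

lemma linearIndependent_modeLp_largeFreq (ha : ∀ i, 0 < a i) (hα : ∀ i, IsLarge (-(α * a i))) :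
    LinearIndependent ℂ fun b : Fin d → Bool => modeLp a (largeFreq a α b) b :=
  linearIndependent_of_ne_zero_of_inner_eq_zero
    (fun b => modeLp_ne_zero (half_mem_box ha) (mode_largeFreq_ne_zero ha hα b))
    fun _ _ hne => inner_modeLp_of_ne (fun i => (ha i).le) hne

lemma algMultiplicity_eq_card (ha : ∀ i, 0 < a i) (hα : ∀ i, 2 * ‖α * a i‖ < (α * a i).re ^ 2)
    (hlarge : ∀ i, IsLarge (-(α * a i)))
    (hμ : ∀ κ b, IsRoot a α κ b → ∑ i, κ i ^ 2 = μ →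
      ∀ i, κ i = largeFreq a α b i ∨ κ i = -largeFreq a α b i) :
    algMultiplicity a α μ = Nat.card {b : Fin d → Bool // largeCurve a b α = μ} := by
  classical
  have hinj := injective_modeCoefficients ha hα hμ
  have : Module.Finite ℂ (⨆ n, kerPow a α μ n : Submodule ℂ (L2Box a)) :=
    Module.Finite.of_injective _ hinj
  have hmem (s : {b : Fin d → Bool // largeCurve a b α = μ}) :
      modeLp a (largeFreq a α s.1) s.1 ∈ ⨆ n, kerPow a α μ n := by
    have hcurve := modeLp_largeFreq_mem_iSup_kerPow ha hlarge s.1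
    rwa [s.2] at hcurve
  have hindep : LinearIndependent ℂ fun s =>
      (⟨_, hmem s⟩ : (⨆ n, kerPow a α μ n : Submodule ℂ (L2Box a))) :=
    LinearIndependent.of_comp (Submodule.subtype _)
      ((linearIndependent_modeLp_largeFreq ha hlarge).comp _ Subtype.val_injective)
  rw [Nat.card_eq_fintype_card]
  refine le_antisymm ?_ hindep.fintype_card_le_finrank
  exact (LinearMap.finrank_le_finrank_of_injective hinj).trans_eq
    (Module.finrank_fintype_fun_eq_card ℂ)

end Multiplicities

/-! ### Curves with large and bounded frequencies -/

section MixedCurves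

variable {d j : ℕ} {a : Fin d → ℝ} {g : ℂ → ℂ} {φ : ℝ}

/-- Frequencies of even modes of which the first `j` are large and the others stay bounded: `g w` is
to be a zero of `charFn false w⁻¹`, analytic near `w = 0`. -/
def mixedFreq (a : Fin d → ℝ) (j : ℕ) (g : ℂ → ℂ) (α : ℂ) (i : Fin d) : ℂ :=
  if (i : ℕ) < j then largeFreq a α (fun _ => false) i else g (α * a i)⁻¹ / a i

/-- The eigenvalue of the mode with frequencies `mixedFreq`, as a function of the Robin
parameter. -/
def mixedCurve (a : Fin d → ℝ) (j : ℕ) (g : ℂ → ℂ) (α : ℂ) : ℂ := ∑ i, mixedFreq a j g α i ^ 2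

lemma tendsto_inv_sectorAtInfty (φ l : ℝ) :
    Tendsto (fun α : ℂ => (α * l)⁻¹) (sectorAtInfty φ) (𝓝 0) := by
  have h : Tendsto (fun α : ℂ => α⁻¹ * (l : ℂ)⁻¹) (sectorAtInfty φ) (𝓝 (0 * (l : ℂ)⁻¹)) :=
    (tendsto_inv₀_cobounded.mono_left inf_le_left).mul_const _
  simpa only [mul_inv, zero_mul] using h

lemma isEigencurve_mixedCurve (ha : ∀ i, 0 < a i) (hφ₀ : 0 < φ) (hφ : φ < π / 2) (j : ℕ)
    (hg : AnalyticAt ℂ g 0)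
    (hroot : ∀ᶠ w in 𝓝 (0 : ℂ), ∀ A, A * w = 1 → charFn false A (g w) = 0) :
    IsEigencurve a φ (mixedCurve a j g) := by
  filter_upwards [eventually_all.2 fun i => eventually_isLarge hφ₀ hφ (ha i),
    eventually_all.2 fun i => (tendsto_inv_sectorAtInfty φ (a i)).eventually hroot,
    eventually_all.2 fun i => (tendsto_inv_sectorAtInfty φ (a i)).eventually
      hg.eventually_analyticAt,
    (tendsto_norm_sectorAtInfty φ).eventually_gt_atTop 0] with α hlarge hroot hg hpos
  have ha0 (i : Fin d) : (a i : ℂ) ≠ 0 := ofReal_ne_zero.2 (ha i).ne'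
  have hαa (i : Fin d) : α * a i ≠ 0 := mul_ne_zero (norm_pos_iff.1 hpos) (ha0 i)
  have hκ : IsRoot a α (mixedFreq a j g α) fun _ => false := fun i => by
    unfold mixedFreq
    split_ifs
    · exact charFn_largeFreq (ha i) (hlarge i) _
    · rw [div_mul_cancel₀ _ (ha0 i)]
      exact hroot i _ (mul_inv_cancel₀ (hαa i))
  have hanalytic (i : Fin d) : AnalyticAt ℂ (fun α => mixedFreq a j g α i) α := by
    unfold mixedFreq
    split_ifs
    · exact analyticAt_largeFreq (hlarge i) _
    · exact ((hg i).comp_of_eq (f := fun α : ℂ => (α * a i)⁻¹)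
        (AnalyticAt.inv (by fun_prop) (hαa i)) rfl).div_const
  exact ⟨hκ.isRobinEigenvalue ha (x := 0) (fun i _ => by simpa using ha i)
      (by simp [mode, phase]),
    Finset.analyticAt_fun_sum _ fun i _ => (hanalytic i).pow 2⟩

lemma tendsto_bounded_freq_sq (φ l : ℝ) (hg : ContinuousAt g 0) :
    Tendsto (fun α : ℂ => (g (α * l)⁻¹ / l) ^ 2) (sectorAtInfty φ) (𝓝 ((g 0 / l) ^ 2)) :=
  ((hg.tendsto.comp (tendsto_inv_sectorAtInfty φ l)).div_const _).pow 2

lemma isEquivalent_mixedCurve (ha : ∀ i, 0 < a i) (hφ₀ : 0 < φ) (hφ : φ < π / 2) (hj : j ≠ 0)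
    (hjd : j ≤ d) (hg : ContinuousAt g 0) :
    mixedCurve a j g ~[sectorAtInfty φ] fun α => -(j : ℂ) * α ^ 2 := by
  refine isEquivalent_of_isLittleO (Nat.cast_ne_zero.2 hj) ?_
  have hfreq (i : Fin d) :
      (fun α => mixedFreq a j g α i ^ 2 + if (i : ℕ) < j then α ^ 2 else 0)
        =o[sectorAtInfty φ] fun α => α ^ 2 := by
    unfold mixedFreq
    split_ifs
    · exact largeFreq_sq_add_isLittleO ha hφ₀ hφ _ i
    · simp only [add_zero]
      refine ((tendsto_bounded_freq_sq φ (a i) hg).isBigO_one ℂ).trans_isLittleO ?_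
      rw [isLittleO_one_left_iff]
      simp only [norm_pow]
      exact (tendsto_pow_atTop two_ne_zero).comp (tendsto_norm_sectorAtInfty φ)
  refine (IsLittleO.sum (s := Finset.univ) fun i _ => hfreq i).congr_left fun α => ?_
  rw [Finset.sum_apply, Finset.sum_add_distrib, Finset.sum_ite, Finset.sum_const_zero, add_zero,
    Finset.sum_const, Fin.card_filter_val_lt, min_eq_right hjd, nsmul_eq_mul, mixedCurve]

lemma eventually_mixedCurve_ne (ha : ∀ i, 0 < a i) (φ : ℝ) (hjd : j < d) {g' : ℂ → ℂ}
    (hg : ContinuousAt g 0) (hg' : ContinuousAt g' 0) (hne : g 0 ^ 2 ≠ g' 0 ^ 2) :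
    ∀ᶠ α in sectorAtInfty φ, mixedCurve a j g α ≠ mixedCurve a j g' α := by
  set c : Fin d → ℝ := fun i => if (i : ℕ) < j then 0 else 1 / a i ^ 2 with hc
  have hfreq (i : Fin d) : Tendsto (fun α => mixedFreq a j g α i ^ 2 - mixedFreq a j g' α i ^ 2)
      (sectorAtInfty φ) (𝓝 ((g 0 ^ 2 - g' 0 ^ 2) * c i)) := by
    unfold mixedFreq
    simp only [hc]
    split_ifs
    · simp only [sub_self, ofReal_zero, mul_zero]
      exact tendsto_const_nhds
    · convert (tendsto_bounded_freq_sq φ (a i) hg).sub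
        (tendsto_bounded_freq_sq φ (a i) hg') using 2
      push_cast
      ring
  have hlim : Tendsto (fun α => mixedCurve a j g α - mixedCurve a j g' α) (sectorAtInfty φ)
      (𝓝 ((g 0 ^ 2 - g' 0 ^ 2) * (∑ i, c i : ℝ))) := by
    simpa only [mixedCurve, Finset.sum_sub_distrib, ← Finset.mul_sum, ← ofReal_sum] using
      tendsto_finsetSum Finset.univ fun i _ => hfreq i
  have hpos : 0 < ∑ i, c i := by
    refine Finset.sum_pos' (fun i _ => ?_) ⟨⟨j, hjd⟩, Finset.mem_univ _, ?_⟩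
    · simp only [hc]
      positivity
    · simpa [hc] using pow_pos (ha ⟨j, hjd⟩) 2
  filter_upwards [hlim.eventually_ne
    (mul_ne_zero (sub_ne_zero.2 hne) (ofReal_ne_zero.2 hpos.ne'))] with α hα
  exact sub_ne_zero.1 hα

lemma tendsto_cobounded_of_isEquivalent {f : ℂ → ℂ} {c : ℂ} (hc : c ≠ 0)
    (h : f ~[sectorAtInfty φ] fun α => c * α ^ 2) : Tendsto f (sectorAtInfty φ) (cobounded ℂ) := by
  rw [← tendsto_norm_atTop_iff_cobounded]
  refine h.isBigO_symm.trans_tendsto_norm_atTop ?_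
  simp only [norm_mul, norm_pow]
  exact ((tendsto_pow_atTop two_ne_zero).comp (tendsto_norm_sectorAtInfty φ)).const_mul_atTop
    (norm_pos_iff.2 hc)

end MixedCurves

/-! ### Asymptotics of the eigenvalues -/

section Spectrum

variable {d : ℕ} {a : Fin d → ℝ} {φ : ℝ}

lemma exists_analyticAt_zero_charFn_half_integer (n : ℕ) :
    ∃ g : ℂ → ℂ, AnalyticAt ℂ g 0 ∧ g 0 = ((n + 1 / 2 : ℝ) * π : ℝ) ∧
      ∀ᶠ w in 𝓝 (0 : ℂ), ∀ A, A * w = 1 → charFn false A (g w) = 0 := by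
  refine exists_analyticAt_zero_charFn (ofReal_ne_zero.2 (by positivity))
    (cos_eq_zero_iff.2 ⟨n, ?_⟩)
  simp only [phase, Bool.false_eq_true, if_false]
  push_cast
  ring

theorem exists_infinitely_many_eigencurves (ha : ∀ i, 0 < a i) (hφ₀ : 0 < φ) (hφ : φ < π / 2)
    {j : ℕ} (hj : j ≠ 0) (hjd : j < d) :
    ∃ lam : ℕ → ℂ → ℂ,
      (∀ n, IsEigencurve a φ (lam n) ∧ Tendsto (lam n) (sectorAtInfty φ) (cobounded ℂ) ∧
        lam n ~[sectorAtInfty φ] fun α => -(j : ℂ) * α ^ 2) ∧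
      ∀ m n, m ≠ n → ∀ᶠ α in sectorAtInfty φ, lam m α ≠ lam n α := by
  choose g hg hg0 hroot using exists_analyticAt_zero_charFn_half_integer
  refine ⟨fun n => mixedCurve a j (g n), fun n => ?_, fun m n hmn => ?_⟩
  · have hequiv := isEquivalent_mixedCurve ha hφ₀ hφ hj hjd.le (hg n).continuousAt
    exact ⟨isEigencurve_mixedCurve ha hφ₀ hφ j (hg n) (hroot n),
      tendsto_cobounded_of_isEquivalent (neg_ne_zero.2 (Nat.cast_ne_zero.2 hj)) hequiv, hequiv⟩
  · refine eventually_mixedCurve_ne ha φ hjd (hg m).continuousAt (hg n).continuousAt ?_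
    rw [hg0, hg0, ← ofReal_pow, ← ofReal_pow, ofReal_inj.ne,
      (sq_eq_sq₀ (by positivity) (by positivity)).ne, (mul_left_inj' Real.pi_pos.ne').ne,
      (add_left_inj _).ne]
    exact Nat.cast_injective.ne hmn

lemma eventually_algMultiplicity_largeCurve (hd : d ≠ 0) (ha : ∀ i, 0 < a i) (hφ₀ : 0 < φ)
    (hφ : φ < π / 2) :
    ∀ᶠ α in sectorAtInfty φ, ∀ b, algMultiplicity a α (largeCurve a b α) =
      Nat.card {b' : Fin d → Bool // largeCurve a b' α = largeCurve a b α} := by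
  filter_upwards [eventually_all.2 fun i => eventually_two_mul_norm_lt hφ₀ hφ (ha i),
    eventually_eq_largeFreq ha hφ₀ hφ,
    eventually_all.2 fun i => eventually_isLarge hφ₀ hφ (ha i),
    eventually_all.2 fun b => eventually_norm_add_le (Nat.cast_ne_zero.2 hd)
      (isEquivalent_largeCurve hd ha hφ₀ hφ b) (tolerance_pos d hφ₀ hφ)]
    with α hα hfreq hlarge hnear b
  exact algMultiplicity_eq_card ha hα hlarge fun κ b' hκ hsum =>
    hfreq κ b' hκ (hsum ▸ hnear b)

lemma eventually_exists_eq_largeCurve (hd : d ≠ 0) (ha : ∀ i, 0 < a i) (hφ₀ : 0 < φ)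
    (hφ : φ < π / 2) {μ : ℂ → ℂ} (hμ : ∀ᶠ α in sectorAtInfty φ, IsRobinEigenvalue a α (μ α))
    (hequiv : μ ~[sectorAtInfty φ] fun α => -(d : ℂ) * α ^ 2) :
    ∀ᶠ α in sectorAtInfty φ, ∃ b, μ α = largeCurve a b α := by
  filter_upwards [eventually_all.2 fun i => eventually_two_mul_norm_lt hφ₀ hφ (ha i),
    eventually_eq_largeFreq ha hφ₀ hφ, hμ,
    eventually_norm_add_le (Nat.cast_ne_zero.2 hd) hequiv (tolerance_pos d hφ₀ hφ)]
    with α hα hfreq hev hnear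
  obtain ⟨κ, b, hκ, hsum⟩ := exists_isRoot_of_isRobinEigenvalue ha hα hev
  exact ⟨b, hsum ▸ sum_sq_eq_largeCurve (hfreq κ b hκ (hsum ▸ hnear))⟩

end Spectrum

end RobinBox

end

theorem theorem8p3 (d : ℕ) (hd : 2 ≤ d) (a : Fin d → ℝ) (ha : ∀ i, 0 < a i)
    (φ : ℝ) (hφ₀ : 0 < φ) (hφ : φ < Real.pi / 2) :
    (∀ j : ℕ, 1 ≤ j → j ≤ d - 1 →
      ∃ lam : ℕ → ℂ → ℂ,
        (∀ n, RobinBox.IsEigencurve a φ (lam n) ∧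
          Tendsto (lam n) (RobinBox.sectorAtInfty φ) (cobounded ℂ) ∧
          lam n ~[RobinBox.sectorAtInfty φ] fun α => -(j : ℂ) * α ^ 2) ∧
        ∀ m n, m ≠ n → ∀ᶠ α in RobinBox.sectorAtInfty φ, lam m α ≠ lam n α) ∧
    ∃ lam : Fin (2 ^ d) → ℂ → ℂ,
      (∀ i, RobinBox.IsEigencurve a φ (lam i) ∧
        lam i ~[RobinBox.sectorAtInfty φ] fun α => -(d : ℂ) * α ^ 2) ∧
      (∀ᶠ α in RobinBox.sectorAtInfty φ, ∀ i,
        RobinBox.algMultiplicity a α (lam i α) = Nat.card {k // lam k α = lam i α}) ∧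
      ∀ μ : ℂ → ℂ,
        (∀ᶠ α in RobinBox.sectorAtInfty φ, RobinBox.IsRobinEigenvalue a α (μ α)) →
        (μ ~[RobinBox.sectorAtInfty φ] fun α => -(d : ℂ) * α ^ 2) →
        ∀ᶠ α in RobinBox.sectorAtInfty φ, ∃ i, μ α = lam i α := by
  have hd0 : d ≠ 0 := by omega
  let e : Fin (2 ^ d) ≃ (Fin d → Bool) := (Fintype.equivFinOfCardEq (by simp)).symm
  refine ⟨fun j hj hjd =>
      RobinBox.exists_infinitely_many_eigencurves ha hφ₀ hφ (by omega) (by omega),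
    fun i => RobinBox.largeCurve a (e i), fun i =>
      ⟨RobinBox.isEigencurve_largeCurve ha hφ₀ hφ (e i),
        RobinBox.isEquivalent_largeCurve hd0 ha hφ₀ hφ (e i)⟩, ?_, fun μ hμ hequiv => ?_⟩
  · filter_upwards [RobinBox.eventually_algMultiplicity_largeCurve hd0 ha hφ₀ hφ] with α hα i
    rw [hα (e i)]
    exact (Nat.card_congr (e.subtypeEquiv fun k => Iff.rfl)).symm
  · filter_upwards [RobinBox.eventually_exists_eq_largeCurve hd0 ha hφ₀ hφ hμ hequiv]
      with α ⟨b, hb⟩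
    exact ⟨e.symm b, by rw [hb, e.apply_symm_apply]⟩
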